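/- Let $\alpha\in\,]0,1[$, let $\vec\Lambda\subset\mathbb C$ be a $\mathbb Z$-lattice (a discrete additive subgroup spanning $\mathbb C$ over $\mathbb R$) of covolume $\operatorname{covol}_{\vec\Lambda}$, and let $\Lambda=z_0+\vec\Lambda$ for some $z_0\in\mathbb C$ be a grid with underlying lattice $\vec\Lambda$. Let $\lambda\in[0,+\infty]$, and let $\phi,\psi$ be two functions from the positive integers to $]0,+\infty[$, both converging to $+\infty$, such that $$\frac{\phi(N)}{N^{1-\alpha}}\to\lambda \text{ as } N\to\infty,\qquad \psi(N)=\Big(\frac{N^{2-\alpha}}{\phi(N)}\Big)^2\text{ for all } N\ge 1 .$$ For $z\in\mathbb C\setminus\{0\}$ and $k\in\mathbb Z$, define the level-$k$ $\alpha$-power $z^{[\alpha,k]}=|z|^\alpha e^{i\alpha\omega_k}$, where $\omega_k$ is the representative of $\arg(z)$ in $[2\pi k,2\pi(k+1)[$. For integers $N\ge 1$ and $N',N''\ge 0$ with $N'+N''\ge 1$, define the level-separated empirical pair correlation measure on $\mathbb C$ by $$\mathcal R^{\alpha,\Lambda,\mathrm{lvl}}_{N,N',N''}=\frac1{(N'+N'')\,\psi(N)}\sum_{k=-N'}^{N''-1}\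 \sum_{\substack{n,m\in\Lambda,\ n\ne m\\ 0<|n|,|m|\le N}}\Delta_{\phi(N)(n^{[\alpha,k]}-m^{[\alpha,k]})},$$ where $\Delta_z$ is the Dirac mass at $z$. Define $\rho_{\alpha,\vec\Lambda,\lambda}:\mathbb C\to[0,+\infty[$ (with value $0$ at $z=0$ when $0<\lambda<+\infty$) by $$\rho_{\alpha,\vec\Lambda,\lambda}(z)=\begin{cases}0&\text{if }\lambda=+\infty,\\[1mm] \dfrac{\pi}{\alpha^2(2-\alpha)\operatorname{covol}_{\vec\Lambda}^2}&\text{if }\lambda=0,\\[3mm] \dfrac{\alpha^{\frac{2}{1-\alpha}}}{(1-\alpha)\operatorname{covol}_{\vec\Lambda}}\Big(\dfrac{|z|}{\lambda}\Big)^{-\frac{4-2\alpha}{1-\alpha}}\displaystyle\sum_{\substack{p\in\vec\Lambda\\ |p|\le\frac{|z|}{\alpha\lambda}}}|p|^{\frac{2}{1-\alpha}}&\text{if }\lambda\in\,]0,+\infty[\,.\end{cases}$$ Then, as $\min\{N,\,N'+N''\}\to\infty$, the positive Radon measures $\mathcal R^{\alpha,\Lambda,\mathrm{lvl}}_{N,N',N''}$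 converge vaguely to the Radon measure $\rho_{\alpha,\vec\Lambda,\lambda}\operatorname{Leb}_{\mathbb C}$; that is, for every continuous function $f:\mathbb C\to\mathbb C$ with compact support, $$\int f\,d\mathcal R^{\alpha,\Lambda,\mathrm{lvl}}_{N,N',N''}\longrightarrow\int_{\mathbb C}f(z)\,\rho_{\alpha,\vec\Lambda,\lambda}(z)\,dz .$$ -/

import Mathlib

open Filter Topology MeasureTheory
open scoped ENNReal

noncomputable section

/-- `Λ` is a grid with underlying lattice `L`, i.e. a translate `z + L`. -/
def IsGridOf (L : Submodule ℤ ℂ) (Λ : Set ℂ) : Prop :=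
  ∃ z : ℂ, Λ = {w : ℂ | ∃ p ∈ L, w = z + p}

/-- The representative of the argument of `z` in `[2πk, 2π(k+1))`. -/
def levelArg (k : ℤ) (z : ℂ) : ℝ :=
  toIcoMod Real.two_pi_pos (2 * Real.pi * (k : ℝ)) (Complex.arg z)

/-- The level-`k` `β`-power `z^[β,k] = |z|^β exp(i β ω_k)`, with `ω_k` the argument of `z` in
`[2πk, 2π(k+1))` (used for `z ≠ 0` only). -/
def levelPow (β : ℝ) (k : ℤ) (z : ℂ) : ℂ :=
  ((‖z‖ ^ β : ℝ) : ℂ) * Complex.exp (Complex.I * ((β * levelArg k z : ℝ) : ℂ))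

/-- The ordered pairs of distinct points of `Λ` whose moduli lie in `(0, N]`. -/
def gridPairs (Λ : Set ℂ) (N : ℕ) : Set (ℂ × ℂ) :=
  {q | q.1 ∈ Λ ∧ q.2 ∈ Λ ∧ q.1 ≠ q.2 ∧
    0 < ‖q.1‖ ∧ ‖q.1‖ ≤ (N : ℝ) ∧ 0 < ‖q.2‖ ∧ ‖q.2‖ ≤ (N : ℝ)}

/-- The level-separated empirical pair correlation measure
`1 / ((N' + N'') ψ(N)) * ∑_{k = -N'}^{N'' - 1} ∑_{(n, m)} Δ_{φ(N) (n^[α,k] - m^[α,k])}`. -/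
def levelPairCorrelation (α : ℝ) (Λ : Set ℂ) (φ ψ : ℕ → ℝ) (N N' N'' : ℕ) : Measure ℂ :=
  ENNReal.ofReal (1 / (((N' : ℝ) + (N'' : ℝ)) * ψ N)) •
    ∑ k ∈ Finset.Ico (-(N' : ℤ)) (N'' : ℤ),
      Measure.sum fun q : gridPairs Λ N =>
        Measure.dirac ((φ N : ℂ) * (levelPow α k q.1.1 - levelPow α k q.1.2))

/-- The limit density `ρ_{α,L,lam}`, where `lam ∈ [0, ∞]`. -/
def limitDensity (α : ℝ) (L : Submodule ℤ ℂ) (lam : ℝ≥0∞) (z : ℂ) : ℝ :=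
  if lam = ⊤ then 0
  else if lam = 0 then Real.pi / (α ^ 2 * (2 - α) * ZLattice.covolume L ^ 2)
  else
    α ^ (2 / (1 - α)) / ((1 - α) * ZLattice.covolume L) *
      (‖z‖ / lam.toReal) ^ (-((4 - 2 * α) / (1 - α))) *
      ∑ᶠ p ∈ {p : ℂ | p ∈ L ∧ ‖p‖ ≤ ‖z‖ / (α * lam.toReal)}, ‖p‖ ^ (2 / (1 - α))

/-- Vague convergence, along a filter `l`, of locally finite Borel measures on `ℂ` (these are
exactly the positive Radon measures on `ℂ`). -/
def VagueTendsto {ι : Type*} (μ : ι → Measure ℂ) (l : Filter ι) (ν : Measure ℂ) : Prop :=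
  (∀ i, IsLocallyFiniteMeasure (μ i)) ∧ IsLocallyFiniteMeasure ν ∧
    ∀ f : ℂ → ℂ, Continuous f → HasCompactSupport f →
      Tendsto (fun i => ∫ z, f z ∂(μ i)) l (𝓝 (∫ z, f z ∂ν))

/-- The finite sum in `limitDensity` is over a finite set. -/
theorem finite_lattice_inter_ball (L : Submodule ℤ ℂ) [DiscreteTopology L] (r : ℝ) :
    {p : ℂ | p ∈ L ∧ ‖p‖ ≤ r}.Finite := by
  have hd : DiscreteTopology L.toAddSubgroup := inferInstanceAs (DiscreteTopology L)
  have hc : IsClosed (L.toAddSubgroup : Set ℂ) := AddSubgroup.isClosed_of_discrete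
  have h := Metric.finite_isBounded_inter_isClosed (K := Metric.closedBall (0 : ℂ) r)
    (s := (L.toAddSubgroup : Set ℂ)) DiscreteTopology.isDiscrete Metric.isBounded_closedBall hc
  refine h.subset fun p hp => ⟨by simpa using hp.2, hp.1⟩

/-- The limit density is Borel measurable. -/
theorem measurable_limitDensity (α : ℝ) (h0 : 0 < α) (L : Submodule ℤ ℂ) [DiscreteTopology L]
    (lam : ℝ≥0∞) : Measurable (limitDensity α L lam) := by
  by_cases h1 : lam = ⊤
  · have : limitDensity α L lam = fun _ => 0 := by ext z; simp [limitDensity, h1]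
    rw [this]; exact measurable_const
  by_cases h2 : lam = 0
  · have : limitDensity α L lam =
        fun _ => Real.pi / (α ^ 2 * (2 - α) * ZLattice.covolume L ^ 2) := by
      ext z; simp [limitDensity, h2]
    rw [this]; exact measurable_const
  have hl : 0 < lam.toReal := ENNReal.toReal_pos h2 h1
  set g : ℝ → ℝ := fun x =>
    ∑ᶠ p ∈ {p : ℂ | p ∈ L ∧ ‖p‖ ≤ x / (α * lam.toReal)}, ‖p‖ ^ (2 / (1 - α)) with hg
  have hmono : Monotone g := by
    intro x y hxy
    have hsub : {p : ℂ | p ∈ L ∧ ‖p‖ ≤ x / (α * lam.toReal)} ⊆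
        {p : ℂ | p ∈ L ∧ ‖p‖ ≤ y / (α * lam.toReal)} :=
      fun p hp => ⟨hp.1, hp.2.trans (by gcongr)⟩
    have fx := finite_lattice_inter_ball L (x / (α * lam.toReal))
    have fy := finite_lattice_inter_ball L (y / (α * lam.toReal))
    simp only [hg]
    rw [finsum_mem_eq_finite_toFinset_sum _ fx, finsum_mem_eq_finite_toFinset_sum _ fy]
    exact Finset.sum_le_sum_of_subset_of_nonneg (by simpa using hsub)
      fun p _ _ => by positivity
  have : limitDensity α L lam = fun z => α ^ (2 / (1 - α)) / ((1 - α) * ZLattice.covolume L) *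
      (‖z‖ / lam.toReal) ^ (-((4 - 2 * α) / (1 - α))) * g ‖z‖ := by
    ext z; simp [limitDensity, h1, h2, hg]
  rw [this]
  have hm := hmono.measurable.comp (measurable_norm (α := ℂ))
  exact (measurable_const.mul ((measurable_norm.div_const _).pow_const _)).mul hm

end

/-!
The level powers `z ↦ z^[α,k]` expand distances on the punctured disc of radius `N` by at least
`α N ^ (α - 1)`, even across the cut (`le_norm_levelPow_sub`). Hence, with `s = φ(N) N ^ (α - 1)`, only
the pairs `(n, n - p)` with `p` in the underlying lattice and `‖p‖ ≤ R / (α s)` contribute to the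
integral of a test function `f` supported in the ball of radius `R`. There are `O(s⁻²)` such `p`, and
`1 / ψ(N) = s² / N²`, so that everything is uniformly bounded.

Writing the sum over the grid points `n` as the integral of a step function (`integral_cellFun`) and
rescaling by `N`, the integral of `f` becomes an integral over the unit disc, whose integrand at `x`
is an average over the levels `k` of sums over `p`. At every `x` off the cut, strict
differentiability of the level power replaces these sums, uniformly in `k`, by
`s² ∑ f (α s p x^[α-1,k])` (`eventually_norm_innerSum_sub_latticeSum_le`), and dominated convergence
applies.

On a circle of radius `r`, the angle of `x^[α-1,k]` is `(α - 1)` times the level-`k` argument. As `k`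
runs over the levels, these arguments fill an interval of length `2π(N' + N'')`, so that the average
tends to the uniform one, for every `α < 1` (`norm_levels_average_sub_le`). What is left is the
integral over `r ∈ (0, 1]` of `r s² ∑ F (α s ‖p‖ r ^ (α - 1))`, where `F` is the circular integral of
`f`. Its limit as `s → λ` is obtained termwise for `0 < λ < ∞`, as a Riemann sum for `λ = 0`, and is
trivial for `λ = ∞`; the substitution `t = α λ ‖p‖ r ^ (α - 1)` identifies it with the integral of `f`
against the limit density.
-/

/-! ### Level powers -/

theorem levelArg_mem (k : ℤ) (z : ℂ) :
    levelArg k z ∈ Set.Ico (2 * Real.pi * k) (2 * Real.pi * k + 2 * Real.pi) :=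
  toIcoMod_mem_Ico _ _ _

theorem levelArg_eq_add (k : ℤ) (z : ℂ) :
    levelArg k z = levelArg 0 z + 2 * Real.pi * k := by
  have := toIcoMod_add_zsmul' Real.two_pi_pos 0 z.arg k
  simp only [zsmul_eq_mul, zero_add] at this
  unfold levelArg
  rw [mul_comm (2 * Real.pi) (k : ℝ), this]
  simp

theorem levelArg_zero_polar {r θ : ℝ} (hr : 0 < r) (hθ : θ ∈ Set.Ico 0 (2 * Real.pi)) :
    levelArg 0 (r * Complex.exp (θ * Complex.I)) = θ := by
  unfold levelArg
  rw [toIcoMod_eq_iff]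
  refine ⟨by simpa using hθ, ?_⟩
  rw [Complex.arg_real_mul _ hr, Complex.arg_exp_mul_I]
  refine ⟨-toIocDiv Real.two_pi_pos (-Real.pi) θ, ?_⟩
  rw [toIocMod]
  module

theorem norm_mul_exp_levelArg (k : ℤ) (z : ℂ) :
    (‖z‖ : ℂ) * Complex.exp (levelArg k z * Complex.I) = z := by
  have h : levelArg k z
      = z.arg + (-toIcoDiv Real.two_pi_pos (2 * Real.pi * k) z.arg : ℤ) * (2 * Real.pi) := by
    unfold levelArg; rw [toIcoMod]; push_cast; simp [sub_eq_add_neg]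
  rw [h]
  have : (((z.arg + (-toIcoDiv Real.two_pi_pos (2 * Real.pi * k) z.arg : ℤ) * (2 * Real.pi) : ℝ)) : ℂ)
      * Complex.I = z.arg * Complex.I
        + (-toIcoDiv Real.two_pi_pos (2 * Real.pi * k) z.arg : ℤ) * (2 * Real.pi * Complex.I) := by
    push_cast; ring
  rw [this, Complex.exp_add, Complex.exp_int_mul_two_pi_mul_I, mul_one,
    Complex.norm_mul_exp_arg_mul_I]

theorem levelArg_real_mul (k : ℤ) {a : ℝ} (ha : 0 < a) (z : ℂ) :
    levelArg k (a * z) = levelArg k z := by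
  unfold levelArg; rw [Complex.arg_real_mul _ ha]

theorem measurable_levelArg (k : ℤ) : Measurable (levelArg k) := by
  have h : levelArg k = fun z : ℂ =>
      (if 0 ≤ z.arg then z.arg else z.arg + 2 * Real.pi) + 2 * Real.pi * k := by
    ext z
    rw [levelArg_eq_add]
    congr 1
    unfold levelArg
    rw [toIcoMod_eq_iff]
    have h1 := Complex.neg_pi_lt_arg z
    have h2 := Complex.arg_le_pi z
    have h3 := Real.pi_pos
    split_ifs with h0
    · exact ⟨⟨by simpa using h0, by simp; linarith⟩, 0, by simp⟩
    · push Not at h0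
      exact ⟨⟨by simp only [Int.cast_zero]; linarith, by simp only [Int.cast_zero]; linarith⟩, -1, by simp⟩
  rw [h]
  exact (Measurable.ite (measurableSet_le measurable_const Complex.measurable_arg)
    Complex.measurable_arg (Complex.measurable_arg.add_const _)).add_const _

theorem measurable_levelPow (β : ℝ) (k : ℤ) : Measurable (levelPow β k) := by
  have := measurable_levelArg k
  unfold levelPow
  fun_prop

/-- Changing the level rotates a level power by a fixed phase. -/
theorem levelPow_eq_phase_mul (β : ℝ) (k : ℤ) (z : ℂ) :
    levelPow β k z
      = Complex.exp ((β * (2 * Real.pi * k) : ℝ) * Complex.I) * levelPow β 0 z := by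
  unfold levelPow
  rw [levelArg_eq_add k z, mul_left_comm, ← Complex.exp_add]
  congr 2
  push_cast; ring

theorem levelPow_real_mul (β : ℝ) (k : ℤ) {a : ℝ} (ha : 0 < a) (z : ℂ) :
    levelPow β k (a * z) = (a ^ β : ℝ) * levelPow β k z := by
  unfold levelPow
  rw [levelArg_real_mul k ha, norm_mul, Complex.norm_real, Real.norm_of_nonneg ha.le,
    Real.mul_rpow ha.le (norm_nonneg _)]
  push_cast; ring

theorem levelPow_polar (β : ℝ) (k : ℤ) {r θ : ℝ} (hr : 0 < r)
    (hθ : θ ∈ Set.Ico 0 (2 * Real.pi)) :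
    levelPow β k (r * Complex.exp (θ * Complex.I))
      = (r ^ β : ℝ) * Complex.exp ((β * (θ + 2 * Real.pi * k) : ℝ) * Complex.I) := by
  unfold levelPow
  rw [levelArg_eq_add, levelArg_zero_polar hr hθ, norm_mul, Complex.norm_exp_ofReal_mul_I,
    mul_one, Complex.norm_real, Real.norm_of_nonneg hr.le, mul_comm Complex.I]

theorem norm_sq_polar_sub (r t a b : ℝ) :
    ‖(r : ℂ) * Complex.exp (a * Complex.I) - t * Complex.exp (b * Complex.I)‖ ^ 2
      = (r - t) ^ 2 + 4 * (r * t) * Real.sin ((a - b) / 2) ^ 2 := by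
  rw [← Complex.normSq_eq_norm_sq, Complex.normSq_apply]
  simp only [Complex.exp_mul_I, ← Complex.ofReal_cos, ← Complex.ofReal_sin]
  simp only [Complex.sub_re, Complex.mul_re, Complex.ofReal_re, Complex.add_re,
    Complex.I_re, Complex.ofReal_im, Complex.I_im, Complex.sub_im, Complex.mul_im, Complex.add_im]
  have h1 : Real.cos (a - b) = 1 - 2 * Real.sin ((a - b) / 2) ^ 2 := by
    have h2 := Real.cos_two_mul ((a - b) / 2)
    have h3 := Real.sin_sq_add_cos_sq ((a - b) / 2)
    rw [mul_div_cancel₀ _ two_ne_zero] at h2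
    linarith
  rw [Real.cos_sub] at h1
  linear_combination r ^ 2 * Real.sin_sq_add_cos_sq a + t ^ 2 * Real.sin_sq_add_cos_sq b
    - 2 * r * t * h1

theorem mul_sin_le_sin_mul {α x : ℝ} (h0 : 0 ≤ α) (h1 : α ≤ 1) (hx0 : 0 ≤ x)
    (hx : x ≤ Real.pi) : α * Real.sin x ≤ Real.sin (α * x) := by
  have := strictConcaveOn_sin_Icc.concaveOn.2 (show x ∈ Set.Icc 0 Real.pi from ⟨hx0, hx⟩)
    (show (0 : ℝ) ∈ Set.Icc 0 Real.pi from ⟨le_rfl, Real.pi_pos.le⟩) h0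
    (sub_nonneg.2 h1) (add_sub_cancel α 1)
  simpa using this

theorem mul_rpow_sub_one_mul_sub_le {α r t : ℝ} (h0 : 0 < α) (h1 : α < 1) (ht : 0 < t)
    (htr : t ≤ r) : α * r ^ (α - 1) * (r - t) ≤ r ^ α - t ^ α := by
  have hr : 0 < r := ht.trans_le htr
  have := rpow_one_add_le_one_add_mul_self (s := t / r - 1) (p := α) (by
    have : 0 ≤ t / r := by positivity
    linarith) h0.le h1.le
  rw [show 1 + (t / r - 1) = t / r by ring, Real.div_rpow ht.le hr.le,
    div_le_iff₀ (by positivity)] at this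
  have e : r ^ α = r ^ (α - 1) * r := by rw [← Real.rpow_add_one hr.ne']; simp
  have e2 : α * (t / r - 1) * r ^ α = - (α * r ^ (α - 1) * (r - t)) := by
    rw [e]; field_simp; ring
  nlinarith

/-- A level power expands distances by at least the factor `α N ^ (α - 1)` on the punctured disc of
radius `N`. This holds across the cut as well, since `sin (α x) ≥ α sin x` on `[0, π]`. -/
theorem le_norm_levelPow_sub {α : ℝ} (h0 : 0 < α) (h1 : α < 1) (k : ℤ) {N : ℝ} {z w : ℂ}
    (hz : z ≠ 0) (hw : w ≠ 0) (hzN : ‖z‖ ≤ N) (hwN : ‖w‖ ≤ N) :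
    α * N ^ (α - 1) * ‖z - w‖ ≤ ‖levelPow α k z - levelPow α k w‖ := by
  wlog hle : ‖w‖ ≤ ‖z‖ generalizing z w
  · rw [norm_sub_rev, norm_sub_rev (levelPow α k z)]
    exact this hw hz hwN hzN (le_of_not_ge hle)
  set r := ‖z‖ with hr
  set t := ‖w‖ with ht
  have hr0 : 0 < r := norm_pos_iff.2 hz
  have ht0 : 0 < t := norm_pos_iff.2 hw
  set a := levelArg k z with ha
  set b := levelArg k w with hb
  have hzz : z = (r : ℂ) * Complex.exp (a * Complex.I) := (norm_mul_exp_levelArg k z).symm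
  have hww : w = (t : ℂ) * Complex.exp (b * Complex.I) := (norm_mul_exp_levelArg k w).symm
  have hzp : levelPow α k z = ((r ^ α : ℝ) : ℂ) * Complex.exp ((α * a : ℝ) * Complex.I) := by
    unfold levelPow; rw [mul_comm Complex.I]
  have hwp : levelPow α k w = ((t ^ α : ℝ) : ℂ) * Complex.exp ((α * b : ℝ) * Complex.I) := by
    unfold levelPow; rw [mul_comm Complex.I]
  have step : α * r ^ (α - 1) * ‖z - w‖ ≤ ‖levelPow α k z - levelPow α k w‖ := by
    refine le_of_sq_le_sq ?_ (norm_nonneg _)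
    rw [mul_pow, hzp, hwp, hzz, hww, norm_sq_polar_sub, norm_sq_polar_sub]
    have hA := mul_rpow_sub_one_mul_sub_le h0 h1 ht0 hle
    have hA' : (α * r ^ (α - 1) * (r - t)) ^ 2 ≤ (r ^ α - t ^ α) ^ 2 :=
      pow_le_pow_left₀ (by have := sub_nonneg.2 hle; positivity) hA 2
    have hS : (α * Real.sin ((a - b) / 2)) ^ 2 ≤ Real.sin ((α * a - α * b) / 2) ^ 2 := by
      have key : (α * Real.sin (|a - b| / 2)) ^ 2 ≤ Real.sin (α * (|a - b| / 2)) ^ 2 := by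
        have hab : |a - b| < 2 * Real.pi := by
          have := levelArg_mem k z; have := levelArg_mem k w
          simp only [Set.mem_Ico] at *
          rw [abs_lt]; constructor <;> linarith
        have hx0 : 0 ≤ |a - b| / 2 := by positivity
        have hx1 : |a - b| / 2 ≤ Real.pi := by linarith
        exact pow_le_pow_left₀ (mul_nonneg h0.le (Real.sin_nonneg_of_nonneg_of_le_pi hx0 hx1))
          (mul_sin_le_sin_mul h0.le h1.le hx0 hx1) 2
      rcases abs_choice (a - b) with h | h <;> rw [h] at key
      · convert key using 3; ring
      · rw [neg_div, mul_neg, Real.sin_neg, Real.sin_neg, mul_neg, neg_sq, neg_sq] at key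
        convert key using 3; ring
    have hP : (r ^ (α - 1)) ^ 2 * (r * t) ≤ r ^ α * t ^ α := by
      have e : r ^ α = r ^ (α - 1) * r := by rw [← Real.rpow_add_one hr0.ne']; simp
      have e' : t ^ α = t ^ (α - 1) * t := by rw [← Real.rpow_add_one ht0.ne']; simp
      have hm : r ^ (α - 1) ≤ t ^ (α - 1) :=
        Real.rpow_le_rpow_of_nonpos ht0 hle (by linarith)
      rw [e, e']
      calc (r ^ (α - 1)) ^ 2 * (r * t) = r ^ (α - 1) * r * (r ^ (α - 1) * t) := by ring
        _ ≤ _ := by gcongr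
    calc (α * r ^ (α - 1)) ^ 2 * ((r - t) ^ 2 + 4 * (r * t) * Real.sin ((a - b) / 2) ^ 2)
        = (α * r ^ (α - 1) * (r - t)) ^ 2
          + 4 * ((r ^ (α - 1)) ^ 2 * (r * t)) * (α * Real.sin ((a - b) / 2)) ^ 2 := by ring
      _ ≤ (r ^ α - t ^ α) ^ 2 + 4 * (r ^ α * t ^ α) * Real.sin ((α * a - α * b) / 2) ^ 2 := by
          gcongr
  refine le_trans ?_ step
  have := Real.rpow_le_rpow_of_nonpos hr0 hzN (show α - 1 ≤ 0 by linarith)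
  gcongr

/-- The condition `-z ∈ slitPlane` says that `z` is off the cut of the level-`0` argument, which is the
nonnegative real half-line. -/
theorem levelArg_zero_eq_arg_neg_add {z : ℂ} (hz : -z ∈ Complex.slitPlane) :
    levelArg 0 z = (-z).arg + Real.pi := by
  have hz0 : -z ≠ 0 := Complex.slitPlane_ne_zero hz
  unfold levelArg
  rw [toIcoMod_eq_iff]
  have h1 := Complex.neg_pi_lt_arg (-z)
  have h2 : (-z).arg < Real.pi :=
    lt_of_le_of_ne (Complex.arg_le_pi _) (Complex.mem_slitPlane_iff_arg.1 hz).1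
  refine ⟨⟨by simp; linarith, by simp; linarith⟩, ?_⟩
  have := Complex.arg_neg_coe_angle hz0
  rw [neg_neg, ← Real.Angle.coe_add, Real.Angle.angle_eq_iff_two_pi_dvd_sub] at this
  obtain ⟨j, hj⟩ := this
  exact ⟨j, by rw [zsmul_eq_mul]; linarith⟩

theorem levelPow_zero_eq_cpow (β : ℝ) {z : ℂ} (hz : -z ∈ Complex.slitPlane) :
    levelPow β 0 z = Complex.exp (β * Real.pi * Complex.I) * (-z) ^ (β : ℂ) := by
  have hz0 : -z ≠ 0 := Complex.slitPlane_ne_zero hz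
  unfold levelPow
  rw [levelArg_zero_eq_arg_neg_add hz, Complex.cpow_def_of_ne_zero hz0, ← Complex.exp_add,
    Complex.log, norm_neg, Real.rpow_def_of_pos (by simpa using hz0), Complex.ofReal_exp,
    ← Complex.exp_add]
  congr 1
  push_cast; ring

theorem hasStrictDerivAt_levelPow_zero (β : ℝ) {z : ℂ} (hz : -z ∈ Complex.slitPlane) :
    HasStrictDerivAt (levelPow β 0) (β * levelPow (β - 1) 0 z) z := by
  have h := (((hasStrictDerivAt_neg z).cpow_const (c := (β : ℂ)) hz).const_mul
    (Complex.exp (β * Real.pi * Complex.I)))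
  have ev : (fun x : ℂ => Complex.exp (β * Real.pi * Complex.I) * (-x) ^ (β : ℂ)) =ᶠ[𝓝 z]
      levelPow β 0 := by
    have : ∀ᶠ x in 𝓝 z, -x ∈ Complex.slitPlane :=
      continuous_neg.continuousAt.eventually (Complex.isOpen_slitPlane.mem_nhds hz)
    filter_upwards [this] with x hx using (levelPow_zero_eq_cpow β hx).symm
  have h2 := h.congr_of_eventuallyEq ev
  refine HasStrictDerivAt.congr_deriv h2 ?_
  rw [levelPow_zero_eq_cpow _ hz]
  have : Complex.exp (((β - 1 : ℝ) : ℂ) * Real.pi * Complex.I)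
      = - Complex.exp (β * Real.pi * Complex.I) := by
    rw [show ((β - 1 : ℝ) : ℂ) * Real.pi * Complex.I
      = β * Real.pi * Complex.I - Real.pi * Complex.I by push_cast; ring, Complex.exp_sub,
      Complex.exp_pi_mul_I]
    rw [div_neg, div_one]
  rw [this]
  push_cast; ring

/-! ### Grids and their cells -/

/-- The nonzero points of the lattice `L` of norm at most `r`. -/
noncomputable def latticeBall (L : Submodule ℤ ℂ) [DiscreteTopology L] (r : ℝ) : Finset ℂ :=
  (finite_lattice_inter_ball L r).toFinset.erase 0

theorem mem_latticeBall {L : Submodule ℤ ℂ} [DiscreteTopology L] {r : ℝ} {p : ℂ} :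
    p ∈ latticeBall L r ↔ p ≠ 0 ∧ p ∈ L ∧ ‖p‖ ≤ r := by
  simp [latticeBall]

theorem latticeBall_mono (L : Submodule ℤ ℂ) [DiscreteTopology L] {r t : ℝ} (h : r ≤ t) :
    latticeBall L r ⊆ latticeBall L t := fun p hp => by
  rw [mem_latticeBall] at *
  exact ⟨hp.1, hp.2.1, hp.2.2.trans h⟩

theorem exists_latticeBall_eq_empty (L : Submodule ℤ ℂ) [DiscreteTopology L] :
    ∃ δ : ℝ, 0 < δ ∧ ∀ r < δ, latticeBall L r = ∅ := by
  by_cases he : (latticeBall L 1).Nonempty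
  · obtain ⟨p, hp, hmin⟩ := (latticeBall L 1).exists_min_image (fun p => ‖p‖) he
    refine ⟨‖p‖, norm_pos_iff.2 (mem_latticeBall.1 hp).1, fun r hr => ?_⟩
    refine Finset.eq_empty_of_forall_notMem fun q hq => ?_
    have h1 : q ∈ latticeBall L 1 :=
      latticeBall_mono L (hr.le.trans (mem_latticeBall.1 hp).2.2) hq
    exact absurd ((hmin q h1).trans (mem_latticeBall.1 hq).2.2) (not_le.2 hr)
  · rw [Finset.not_nonempty_iff_eq_empty] at he
    exact ⟨1, one_pos, fun r hr => Finset.subset_empty.1 (he ▸ latticeBall_mono L hr.le)⟩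

section Cells

variable (L : Submodule ℤ ℂ) [DiscreteTopology L] [IsZLattice ℝ L]

/-- A real basis of `ℂ` that is an integral basis of the lattice `L`. -/
noncomputable def latticeBasis : Module.Basis (Module.Free.ChooseBasisIndex ℤ L) ℝ ℂ :=
  (Module.Free.chooseBasis ℤ L).ofZLatticeBasis ℝ L

/-- The point `n` of the grid `z₀ + L` whose cell, the translate by `n` of a fundamental
parallelogram of `L`, contains `x`. -/
noncomputable def gridPoint (z₀ x : ℂ) : ℂ := z₀ + ZSpan.floor (latticeBasis L) (x - z₀)

theorem span_latticeBasis : Submodule.span ℤ (Set.range (latticeBasis L)) = L :=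
  (Module.Free.chooseBasis ℤ L).ofZLatticeBasis_span ℝ L

theorem gridPoint_sub_mem (z₀ x : ℂ) : gridPoint L z₀ x - z₀ ∈ L := by
  have h := (ZSpan.floor (latticeBasis L) (x - z₀)).2
  have e : gridPoint L z₀ x - z₀ = ZSpan.floor (latticeBasis L) (x - z₀) := by
    unfold gridPoint; ring
  rw [e]
  exact (span_latticeBasis L).le h

theorem exists_norm_gridPoint_sub_le :
    ∃ C : ℝ, 0 < C ∧ ∀ z₀ x : ℂ, ‖gridPoint L z₀ x - x‖ ≤ C := by
  refine ⟨∑ i, ‖latticeBasis L i‖ + 1, by positivity, fun z₀ x => ?_⟩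
  have h := ZSpan.norm_fract_le (latticeBasis L) (x - z₀)
  rw [ZSpan.fract_apply] at h
  rw [← norm_neg, show -(gridPoint L z₀ x - x)
    = x - z₀ - ZSpan.floor (latticeBasis L) (x - z₀) by unfold gridPoint; ring]
  linarith

theorem gridPoint_preimage {z₀ n : ℂ} (hn : n - z₀ ∈ L) :
    {x | gridPoint L z₀ x = n} = (fun x => x - n) ⁻¹' ZSpan.fundamentalDomain (latticeBasis L) := by
  have hn' : n - z₀ ∈ Submodule.span ℤ (Set.range (latticeBasis L)) := by
    rwa [span_latticeBasis]
  ext x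
  have h1 : ZSpan.fract (latticeBasis L) (x - n) = ZSpan.fract (latticeBasis L) (x - z₀) := by
    rw [ZSpan.fract_eq_fract]
    convert hn' using 1; ring
  have h2 := ZSpan.fract_apply (latticeBasis L) (x - z₀)
  simp only [Set.mem_ofPred_eq, Set.mem_preimage]
  rw [← ZSpan.fract_eq_self, h1, h2, gridPoint]
  constructor
  · intro h; rw [← h]; ring
  · intro h; linear_combination -h

theorem measurableSet_gridPoint_eq {z₀ n : ℂ} (hn : n - z₀ ∈ L) :
    MeasurableSet {x | gridPoint L z₀ x = n} := by
  rw [gridPoint_preimage L hn]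
  exact (measurable_id.sub_const n) (ZSpan.fundamentalDomain_measurableSet _)

theorem volume_gridPoint_eq {z₀ n : ℂ} (hn : n - z₀ ∈ L) :
    volume {x | gridPoint L z₀ x = n} = ENNReal.ofReal (ZLattice.covolume L) := by
  have hfin : volume (ZSpan.fundamentalDomain
      ((Module.Free.chooseBasis ℤ L).ofZLatticeBasis ℝ L)) ≠ ⊤ :=
    (ZSpan.fundamentalDomain_isBounded _).measure_lt_top.ne
  have e : (fun x : ℂ => x - n) = fun x => x + -n := funext fun x => sub_eq_add_neg x n
  rw [gridPoint_preimage L hn, e, measure_preimage_add_right,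
    ZLattice.covolume_eq_measure_fundamentalDomain L volume
      (ZLattice.isAddFundamentalDomain (Module.Free.chooseBasis ℤ L) volume), ofReal_measureReal hfin]
  rfl

/-- The step function equal to `h n` on the cell of `n`, for `n` in a finite part `S` of the grid. -/
noncomputable def cellFun (z₀ : ℂ) (S : Finset ℂ) (h : ℂ → ℂ) (x : ℂ) : ℂ :=
  if gridPoint L z₀ x ∈ S then h (gridPoint L z₀ x) else 0

theorem cellFun_eq_sum (z₀ : ℂ) (S : Finset ℂ) (h : ℂ → ℂ) (x : ℂ) :
    cellFun L z₀ S h x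
      = ∑ n ∈ S, Set.indicator {x | gridPoint L z₀ x = n} (fun _ => h n) x := by
  simp [cellFun, Set.indicator_apply]

theorem measurable_cellFun {z₀ : ℂ} {S : Finset ℂ} (hS : ∀ n ∈ S, n - z₀ ∈ L) (h : ℂ → ℂ) :
    Measurable (cellFun L z₀ S h) := by
  have e : cellFun L z₀ S h = _ := funext (cellFun_eq_sum L z₀ S h)
  rw [e]
  exact Finset.measurable_fun_sum _ fun n hn =>
    measurable_const.indicator (measurableSet_gridPoint_eq L (hS n hn))

theorem integrable_indicator_gridPoint_eq {z₀ n : ℂ} (hn : n - z₀ ∈ L) (c : ℂ) :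
    Integrable (Set.indicator {x | gridPoint L z₀ x = n} fun _ => c) := by
  rw [integrable_indicator_iff (measurableSet_gridPoint_eq L hn)]
  refine integrableOn_const ?_
  rw [volume_gridPoint_eq L hn]
  exact ENNReal.ofReal_ne_top

theorem integrable_cellFun {z₀ : ℂ} {S : Finset ℂ} (hS : ∀ n ∈ S, n - z₀ ∈ L) (h : ℂ → ℂ) :
    Integrable (cellFun L z₀ S h) := by
  have e : cellFun L z₀ S h = _ := funext (cellFun_eq_sum L z₀ S h)
  rw [e]
  exact integrable_finsetSum _ fun n hn => integrable_indicator_gridPoint_eq L (hS n hn) _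

theorem integral_cellFun {z₀ : ℂ} {S : Finset ℂ} (hS : ∀ n ∈ S, n - z₀ ∈ L) (h : ℂ → ℂ) :
    ∫ x, cellFun L z₀ S h x = ZLattice.covolume L * ∑ n ∈ S, h n := by
  simp_rw [cellFun_eq_sum]
  rw [integral_finsetSum, Finset.mul_sum]
  · refine Finset.sum_congr rfl fun n hn => ?_
    rw [integral_indicator (measurableSet_gridPoint_eq L (hS n hn)), setIntegral_const,
      measureReal_def, volume_gridPoint_eq L (hS n hn),
      ENNReal.toReal_ofReal (ZLattice.covolume_pos L _).le, Complex.real_smul]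
  · exact fun n hn => integrable_indicator_gridPoint_eq L (hS n hn) _

/-- The number of nonzero lattice points of norm at most `r` is `O(r²)`, for small `r` too. -/
theorem exists_card_latticeBall_le :
    ∃ C : ℝ, 0 < C ∧ ∀ r : ℝ, ((latticeBall L r).card : ℝ) ≤ C * r ^ 2 := by
  obtain ⟨δ, hδ, hempty⟩ := exists_latticeBall_eq_empty L
  obtain ⟨C, hC, hdist⟩ := exists_norm_gridPoint_sub_le L
  have hcov : 0 < ZLattice.covolume L := ZLattice.covolume_pos L _
  refine ⟨Real.pi * (1 + C / δ) ^ 2 / ZLattice.covolume L, by positivity, fun r => ?_⟩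
  rcases lt_or_ge r δ with hr | hr
  · rw [hempty r hr]; simp; positivity
  have hr0 : 0 < r := hδ.trans_le hr
  set S := latticeBall L r
  have hS : ∀ n ∈ S, n - 0 ∈ L := fun n hn => by simpa using (mem_latticeBall.1 hn).2.1
  have hdisj : (S : Set ℂ).PairwiseDisjoint fun n => {x | gridPoint L 0 x = n} := by
    intro n _ m _ hnm
    refine Set.disjoint_left.2 fun x hx hx' => hnm ?_
    simp only [Set.mem_ofPred_eq] at hx hx'
    exact hx.symm.trans hx'
  have hvol := measure_biUnion_finset (μ := volume) hdisj
    fun n hn => measurableSet_gridPoint_eq L (hS n hn)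
  rw [Finset.sum_congr rfl fun n hn => volume_gridPoint_eq L (hS n hn), Finset.sum_const] at hvol
  have hsub : (⋃ n ∈ S, {x | gridPoint L 0 x = n}) ⊆ Metric.closedBall 0 (r + C) := by
    intro x hx
    simp only [Set.mem_iUnion, Set.mem_ofPred_eq, exists_prop] at hx
    obtain ⟨n, hn, hxn⟩ := hx
    have h1 := hdist 0 x
    have h2 := (mem_latticeBall.1 hn).2.2
    rw [hxn] at h1
    rw [mem_closedBall_zero_iff]
    calc ‖x‖ = ‖n - (n - x)‖ := by ring_nf
      _ ≤ ‖n‖ + ‖n - x‖ := norm_sub_le _ _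
      _ ≤ r + C := by linarith
  have hle := measure_mono (μ := volume) hsub
  rw [hvol, Complex.volume_closedBall] at hle
  have hle' := ENNReal.toReal_mono (by finiteness) hle
  rw [nsmul_eq_mul, ENNReal.toReal_mul, ENNReal.toReal_natCast, ENNReal.toReal_ofReal hcov.le,
    ENNReal.toReal_mul, ENNReal.toReal_pow, ENNReal.toReal_ofReal (by positivity)] at hle'
  have hrC : r + C ≤ (1 + C / δ) * r := by
    have : C ≤ C / δ * r := by
      rw [div_mul_eq_mul_div, le_div_iff₀ hδ]; gcongr
    linarith
  rw [div_mul_eq_mul_div, le_div_iff₀ hcov]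
  calc (S.card : ℝ) * ZLattice.covolume L ≤ (r + C) ^ 2 * Real.pi := hle'
    _ ≤ ((1 + C / δ) * r) ^ 2 * Real.pi := by gcongr
    _ = Real.pi * (1 + C / δ) ^ 2 * r ^ 2 := by ring

end Cells

/-! ### Polar coordinates and averages of periodic functions -/

theorem periodic_comp_circle (f : ℂ → ℂ) (w : ℂ) :
    Function.Periodic (fun θ : ℝ => f (w * Complex.exp (θ * Complex.I))) (2 * Real.pi) := by
  intro θ
  simp only
  rw [show ((θ + 2 * Real.pi : ℝ) : ℂ) * Complex.I = θ * Complex.I + 2 * Real.pi * Complex.I by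
    push_cast; ring, Complex.exp_add, Complex.exp_two_pi_mul_I, mul_one]

/-- Integration in polar coordinates, with angles in `[0, 2π]` instead of `(-π, π)`. -/
theorem integral_eq_integral_polar {H : ℂ → ℂ} (hm : Measurable H) (hH : Integrable H) :
    ∫ z, H z = ∫ r in Set.Ioi (0 : ℝ),
      (r : ℂ) * ∫ θ in (0 : ℝ)..2 * Real.pi, H (r * Complex.exp (θ * Complex.I)) := by
  have hpt : ∀ p : ℝ × ℝ, Complex.polarCoord.symm p = p.1 * Complex.exp (p.2 * Complex.I) := by
    intro p
    rw [Complex.polarCoord_symm_apply, Complex.exp_mul_I]; push_cast; rfl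
  have hmeas : Measurable fun p : ℝ × ℝ => p.1 • H (p.1 * Complex.exp (p.2 * Complex.I)) := by
    fun_prop
  have hint : IntegrableOn (fun p : ℝ × ℝ => p.1 • H (p.1 * Complex.exp (p.2 * Complex.I)))
      (Set.Ioi 0 ×ˢ Set.Ioo (-Real.pi) Real.pi) (volume.prod volume) := by
    refine ⟨hmeas.aestronglyMeasurable, ?_⟩
    have h1 := hH.2
    rw [HasFiniteIntegral, ← Complex.lintegral_comp_polarCoord_symm] at h1
    refine lt_of_le_of_lt (le_of_eq ?_) h1
    refine setLIntegral_congr_fun (measurableSet_Ioi.prod measurableSet_Ioo) fun p hp => ?_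
    have : 0 < p.1 := hp.1
    rw [enorm_smul, hpt, Real.enorm_eq_ofReal this.le, smul_eq_mul]
  rw [← Complex.integral_comp_polarCoord_symm, polarCoord_target]
  simp_rw [hpt]
  rw [Measure.volume_eq_prod, setIntegral_prod _ hint]
  refine setIntegral_congr_fun measurableSet_Ioi fun r _ => ?_
  simp only [Complex.real_smul]
  rw [integral_const_mul]
  congr 1
  have h3 := (periodic_comp_circle H r).intervalIntegral_add_eq (-Real.pi) 0
  rw [zero_add, show -Real.pi + 2 * Real.pi = Real.pi by ring] at h3
  rw [← h3, intervalIntegral.integral_of_le (by linarith [Real.pi_pos]), integral_Ioc_eq_integral_Ioo]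

/-- The integral of `f` over the circle of radius `ρ` with respect to the angle. -/
noncomputable def circleInt (f : ℂ → ℂ) (ρ : ℝ) : ℂ :=
  ∫ θ in (0 : ℝ)..2 * Real.pi, f (ρ * Complex.exp (θ * Complex.I))

/-- The integral over a circle does not depend on the starting point. -/
theorem integral_circle_eq_circleInt (f : ℂ → ℂ) (w : ℂ) :
    ∫ θ in (0 : ℝ)..2 * Real.pi, f (w * Complex.exp (θ * Complex.I)) = circleInt f ‖w‖ := by
  have e : ∀ θ : ℝ, w * Complex.exp (θ * Complex.I)
      = (‖w‖ : ℂ) * Complex.exp (((θ + w.arg : ℝ) : ℂ) * Complex.I) := by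
    intro θ
    conv_lhs => rw [← Complex.norm_mul_exp_arg_mul_I w]
    rw [mul_assoc, ← Complex.exp_add]; congr 2; push_cast; ring
  simp_rw [e]
  rw [intervalIntegral.integral_comp_add_right
    (fun θ : ℝ => f ((‖w‖ : ℂ) * Complex.exp (θ * Complex.I)))]
  have := (periodic_comp_circle f ‖w‖).intervalIntegral_add_eq w.arg 0
  rw [zero_add, add_comm] at this ⊢
  rw [add_comm w.arg, circleInt, ← this, add_comm]

theorem continuous_circleInt {f : ℂ → ℂ} (hf : Continuous f) : Continuous (circleInt f) := by
  unfold circleInt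
  exact intervalIntegral.continuous_parametric_intervalIntegral_of_continuous' (by fun_prop) _ _

theorem norm_circleInt_le {f : ℂ → ℂ} {K : ℝ} (hK : ∀ z, ‖f z‖ ≤ K) (ρ : ℝ) :
    ‖circleInt f ρ‖ ≤ 2 * Real.pi * K := by
  have := intervalIntegral.norm_integral_le_of_norm_le_const (a := 0) (b := 2 * Real.pi)
    (f := fun θ : ℝ => f (ρ * Complex.exp (θ * Complex.I))) (C := K) fun θ _ => hK _
  rw [sub_zero, abs_of_pos Real.two_pi_pos] at this
  rw [circleInt]; linarith

theorem circleInt_eq_zero {f : ℂ → ℂ} {R : ℝ} (hR : ∀ z, R < ‖z‖ → f z = 0) {ρ : ℝ}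
    (hρ : R < ρ) : circleInt f ρ = 0 := by
  unfold circleInt
  rw [intervalIntegral.integral_congr (g := fun _ => 0)]
  · simp
  · intro θ _
    refine hR _ ?_
    rw [norm_mul, Complex.norm_exp_ofReal_mul_I, mul_one, Complex.norm_real]
    exact hρ.trans_le (le_abs_self ρ)

theorem integral_radial_mul {f : ℂ → ℂ} (hf : Continuous f) {g : ℝ → ℝ}
    (hg : Measurable g) (hint : Integrable fun z => (g ‖z‖ : ℂ) * f z) :
    ∫ z, (g ‖z‖ : ℂ) * f z = ∫ r in Set.Ioi (0 : ℝ), ((r * g r : ℝ) : ℂ) * circleInt f r := by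
  have hfm := hf.measurable
  rw [integral_eq_integral_polar (by fun_prop) hint]
  refine setIntegral_congr_fun measurableSet_Ioi fun r hr => ?_
  have hr : 0 < r := hr
  simp only [norm_mul, Complex.norm_exp_ofReal_mul_I, mul_one, Complex.norm_real,
    Real.norm_of_nonneg hr.le]
  rw [intervalIntegral.integral_const_mul, circleInt]
  push_cast; ring

/-- The integral of a bounded periodic function over an interval is the length of the interval
times the mean, up to a bounded error. -/
theorem norm_integral_sub_mean_le {h : ℝ → ℂ} (hc : Continuous h) {T K : ℝ} (hT : 0 < T)
    (hp : Function.Periodic h T) (hK : ∀ x, ‖h x‖ ≤ K) (c d : ℝ) :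
    ‖(∫ x in c..d, h x) - ((d - c) / T : ℝ) * ∫ x in (0 : ℝ)..T, h x‖ ≤ 2 * T * K := by
  have hint : ∀ a b, IntervalIntegrable h volume a b := fun a b => hc.intervalIntegrable a b
  have hK0 : 0 ≤ K := (norm_nonneg _).trans (hK 0)
  set j := toIcoDiv hT c d with hj
  set e := toIcoMod hT c d with he
  have hd : d = e + j • T := (toIcoMod_add_toIcoDiv_zsmul hT c d).symm
  have heI : e ∈ Set.Ico c (c + T) := toIcoMod_mem_Ico hT c d
  have h1 : ∫ x in e..d, h x = j • ∫ x in (0 : ℝ)..T, h x := by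
    rw [hd, hp.intervalIntegral_add_zsmul_eq j e hint, hp.intervalIntegral_add_eq e 0, zero_add]
  have h2 : ‖∫ x in c..e, h x‖ ≤ K * T := by
    refine (intervalIntegral.norm_integral_le_of_norm_le_const fun x _ => hK x).trans ?_
    rw [abs_of_nonneg (by linarith [heI.1])]
    gcongr; linarith [heI.2]
  have h3 : ‖∫ x in (0 : ℝ)..T, h x‖ ≤ K * T := by
    refine (intervalIntegral.norm_integral_le_of_norm_le_const fun x _ => hK x).trans ?_
    rw [sub_zero, abs_of_pos hT]
  have h4 : ((d - c) / T : ℝ) = (e - c) / T + j := by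
    rw [hd, zsmul_eq_mul]; field_simp; ring
  rw [← intervalIntegral.integral_add_adjacent_intervals (hint c e) (hint e d), h1, h4]
  rw [show (∫ x in c..e, h x) + j • (∫ x in (0 : ℝ)..T, h x)
      - (((e - c) / T + j : ℝ) : ℂ) * ∫ x in (0 : ℝ)..T, h x
      = (∫ x in c..e, h x) - ((e - c) / T : ℝ) * ∫ x in (0 : ℝ)..T, h x by
    push_cast; rw [zsmul_eq_mul]; ring]
  refine (norm_sub_le _ _).trans ?_
  rw [norm_mul, Complex.norm_real, Real.norm_of_nonneg (by
    have := heI.1; have : 0 ≤ e - c := by linarith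
    positivity)]
  have h5 : (e - c) / T ≤ 1 := by rw [div_le_one hT]; linarith [heI.2]
  calc ‖∫ x in c..e, h x‖ + (e - c) / T * ‖∫ x in (0 : ℝ)..T, h x‖ ≤ K * T + 1 * (K * T) := by
        gcongr
    _ = 2 * T * K := by ring

/-- Summing over consecutive levels unrolls the angle along an interval of length `2π(N' + N'')`. -/
theorem sum_levels_integral {h : ℝ → ℂ} (hc : Continuous h) (N' N'' : ℕ) :
    ∑ k ∈ Finset.Ico (-(N' : ℤ)) (N'' : ℤ),
      ∫ θ in (0 : ℝ)..2 * Real.pi, h (θ + 2 * Real.pi * k)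
      = ∫ x in (-(2 * Real.pi * N'))..(2 * Real.pi * N''), h x := by
  have h1 := intervalIntegral.sum_integral_adjacent_intervals (μ := volume) (f := h)
    (a := fun j : ℕ => 2 * Real.pi * ((j : ℝ) - N')) (n := N' + N'')
    fun k _ => hc.intervalIntegrable _ _
  simp only [Nat.cast_zero, zero_sub, Nat.cast_add, add_sub_cancel_left, mul_neg] at h1
  rw [← h1]
  symm
  refine Finset.sum_bij' (fun (j : ℕ) _ => (j : ℤ) - N') (fun (k : ℤ) _ => (k + N').toNat)
    ?_ ?_ ?_ ?_ ?_
  · intro j hj; simp only [Finset.mem_range, Finset.mem_Ico] at *; omega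
  · intro k hk; simp only [Finset.mem_range, Finset.mem_Ico] at *; omega
  · intro j hj; simp
  · intro k hk; simp only [Finset.mem_Ico] at hk; omega
  · intro j hj
    rw [intervalIntegral.integral_comp_add_right h]
    congr 1 <;> push_cast <;> ring

/-- For `β ≠ 0`, averaging over many consecutive levels a function of the angle `βθ` gives the
uniform mean over the circle, with an error of order the inverse of the number of levels. -/
theorem norm_levels_average_sub_le {h : ℝ → ℂ} (hc : Continuous h) {K : ℝ}
    (hp : Function.Periodic h (2 * Real.pi)) (hK : ∀ x, ‖h x‖ ≤ K) {β : ℝ} (hβ : β ≠ 0)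
    {N' N'' : ℕ} (hN : 0 < N' + N'') :
    ‖((1 / ((N' : ℝ) + N'') : ℝ) : ℂ) * ∑ k ∈ Finset.Ico (-(N' : ℤ)) (N'' : ℤ),
        (∫ θ in (0 : ℝ)..2 * Real.pi, h (β * (θ + 2 * Real.pi * k)))
      - ∫ θ in (0 : ℝ)..2 * Real.pi, h θ‖ ≤ 4 * Real.pi * K / (|β| * ((N' : ℝ) + N'')) := by
  rw [sum_levels_integral (h := fun x => h (β * x)) (by fun_prop),
    intervalIntegral.integral_comp_mul_left _ hβ]
  have hM : (0 : ℝ) < (N' : ℝ) + N'' := by exact_mod_cast hN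
  set M := (N' : ℝ) + N'' with hMdef
  have key := norm_integral_sub_mean_le hc Real.two_pi_pos hp hK
    (β * -(2 * Real.pi * N')) (β * (2 * Real.pi * N''))
  set A := ∫ x in (β * -(2 * Real.pi * N'))..(β * (2 * Real.pi * N'')), h x
  set B := ∫ x in (0 : ℝ)..2 * Real.pi, h x
  have e1 : (β * (2 * Real.pi * N'') - β * -(2 * Real.pi * N')) / (2 * Real.pi) = β * M := by
    rw [hMdef]; field_simp [Real.pi_pos.ne']; ring
  rw [e1] at key
  have e2 : ((1 / M : ℝ) : ℂ) * β⁻¹ • A - B = ((1 / (β * M) : ℝ) : ℂ) * (A - ((β * M : ℝ) : ℂ) * B) := by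
    have : (M : ℂ) ≠ 0 := by exact_mod_cast hM.ne'
    have : (β : ℂ) ≠ 0 := by exact_mod_cast hβ
    rw [Complex.real_smul]
    push_cast; field_simp
  rw [e2, norm_mul, Complex.norm_real, Real.norm_eq_abs, abs_div, abs_one, abs_mul, abs_of_pos hM,
    div_mul_eq_mul_div, one_mul]
  gcongr
  linarith

/-! ### The empirical sum as an integral of step functions -/

theorem finite_gridBall (L : Submodule ℤ ℂ) [DiscreteTopology L] (z₀ : ℂ) (r : ℝ) :
    {n : ℂ | n - z₀ ∈ L ∧ 0 < ‖n‖ ∧ ‖n‖ ≤ r}.Finite := by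
  refine ((finite_lattice_inter_ball L (r + ‖z₀‖)).image (fun p => p + z₀)).subset ?_
  rintro n ⟨h1, -, h3⟩
  exact ⟨n - z₀, ⟨h1, (norm_sub_le _ _).trans (by gcongr)⟩, sub_add_cancel _ _⟩

/-- The points of the grid `z₀ + L` with modulus in `(0, r]`. -/
noncomputable def gridBall (L : Submodule ℤ ℂ) [DiscreteTopology L] (z₀ : ℂ) (r : ℝ) : Finset ℂ :=
  (finite_gridBall L z₀ r).toFinset

theorem mem_gridBall {L : Submodule ℤ ℂ} [DiscreteTopology L] {z₀ : ℂ} {r : ℝ} {n : ℂ} :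
    n ∈ gridBall L z₀ r ↔ n - z₀ ∈ L ∧ 0 < ‖n‖ ∧ ‖n‖ ≤ r := by
  simp [gridBall]

/-- The contribution to the level-`k` pair sum of the pairs with first component `n`. -/
noncomputable def innerSum (α : ℝ) (L : Submodule ℤ ℂ) [DiscreteTopology L] (z₀ : ℂ) (f : ℂ → ℂ)
    (c : ℝ) (N : ℕ) (k : ℤ) (n : ℂ) : ℂ :=
  ∑ m ∈ (gridBall L z₀ N).erase n, f (c * (levelPow α k n - levelPow α k m))

theorem gridPairs_eq_biUnion {L : Submodule ℤ ℂ} [DiscreteTopology L] {z₀ : ℂ} {Λ : Set ℂ}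
    (hΛ : Λ = {w : ℂ | ∃ p ∈ L, w = z₀ + p}) (N : ℕ) :
    gridPairs Λ N = (((gridBall L z₀ N).sigma fun n => (gridBall L z₀ N).erase n).image
      fun q : (_ : ℂ) × ℂ => (q.1, q.2) : Finset (ℂ × ℂ)) := by
  have hmem : ∀ w, w ∈ Λ ↔ w - z₀ ∈ L := by
    intro w
    rw [hΛ]
    simp only [Set.mem_ofPred_eq]
    exact ⟨fun ⟨p, hp, h⟩ => by rw [h]; simpa using hp, fun h => ⟨_, h, by ring⟩⟩
  ext ⟨n, m⟩
  simp only [gridPairs, Set.mem_ofPred_eq, Finset.coe_image, Set.mem_image, Finset.mem_coe,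
    Finset.mem_sigma, Finset.mem_erase, mem_gridBall, hmem]
  constructor
  · rintro ⟨h1, h2, h3, h4, h5, h6, h7⟩
    exact ⟨⟨n, m⟩, ⟨⟨h1, h4, h5⟩, Ne.symm h3, h2, h6, h7⟩, rfl⟩
  · rintro ⟨⟨a, b⟩, ⟨⟨h1, h4, h5⟩, h3, h2, h6, h7⟩, h⟩
    simp only [Prod.mk.injEq] at h
    obtain ⟨rfl, rfl⟩ := h
    exact ⟨h1, h2, Ne.symm h3, h4, h5, h6, h7⟩

theorem finite_gridPairs {L : Submodule ℤ ℂ} [DiscreteTopology L] {Λ : Set ℂ}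
    (hΛ : IsGridOf L Λ) (N : ℕ) : (gridPairs Λ N).Finite := by
  obtain ⟨z₀, h⟩ := hΛ
  rw [gridPairs_eq_biUnion h N]
  exact Finset.finite_toSet _

theorem isFiniteMeasure_levelPairCorrelation {L : Submodule ℤ ℂ} [DiscreteTopology L] {Λ : Set ℂ}
    (hΛ : IsGridOf L Λ) (α : ℝ) (φ ψ : ℕ → ℝ) (N N' N'' : ℕ) :
    IsFiniteMeasure (levelPairCorrelation α Λ φ ψ N N' N'') := by
  have := (finite_gridPairs hΛ N).fintype
  unfold levelPairCorrelation
  simp_rw [Measure.sum_fintype]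
  refine Measure.smul_finite _ ENNReal.ofReal_ne_top

theorem integral_levelPairCorrelation {L : Submodule ℤ ℂ} [DiscreteTopology L] {z₀ : ℂ} {Λ : Set ℂ}
    (hΛ : Λ = {w : ℂ | ∃ p ∈ L, w = z₀ + p}) (α : ℝ) (φ ψ : ℕ → ℝ) {N : ℕ} (N' N'' : ℕ)
    (hψ : 0 ≤ ψ N) (f : ℂ → ℂ) :
    ∫ z, f z ∂(levelPairCorrelation α Λ φ ψ N N' N'')
      = ((1 / (((N' : ℝ) + N'') * ψ N) : ℝ) : ℂ) * ∑ k ∈ Finset.Ico (-(N' : ℤ)) (N'' : ℤ),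
          ∑ n ∈ gridBall L z₀ N, innerSum α L z₀ f (φ N) N k n := by
  have := (finite_gridPairs ⟨z₀, hΛ⟩ N).fintype
  unfold levelPairCorrelation
  simp_rw [Measure.sum_fintype]
  have hi : ∀ a, Integrable f (Measure.dirac a) := fun a => integrable_dirac (by finiteness)
  rw [integral_smul_measure, ENNReal.toReal_ofReal (by positivity), Complex.real_smul,
    integral_finsetSum_measure]
  · congr 1
    refine Finset.sum_congr rfl fun k _ => ?_
    rw [integral_finsetSum_measure fun i _ => hi _]
    simp_rw [integral_dirac]
    have e : (gridPairs Λ N).toFinset = _ :=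
      Finset.coe_injective ((Set.coe_toFinset _).trans (gridPairs_eq_biUnion hΛ N))
    rw [Finset.sum_set_coe (gridPairs Λ N)
      (f := fun q : ℂ × ℂ => f (φ N * (levelPow α k q.1 - levelPow α k q.2))), e,
      Finset.sum_image, Finset.sum_sigma]
    · rfl
    · rintro ⟨a, b⟩ _ ⟨c, d⟩ _ h
      simp only [Prod.mk.injEq] at h
      obtain ⟨rfl, rfl⟩ := h
      rfl
  · intro k _
    exact integrable_finsetSum_measure.2 fun i _ => hi _

/-- Rescaling factor between the grid and the images of its points under the level powers: near the
circle of radius `N` the map `z ↦ φ(N) z^[α,k]` dilates by about `α φ(N) N ^ (α - 1)`. -/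
noncomputable def scale (α : ℝ) (φ : ℕ → ℝ) (N : ℕ) : ℝ := φ N * (N : ℝ) ^ (α - 1)

theorem scale_mul_natCast (α : ℝ) (φ : ℕ → ℝ) {N : ℕ} (hN : 1 ≤ N) :
    scale α φ N * N = φ N * (N : ℝ) ^ α := by
  have hN0 : (N : ℝ) ≠ 0 := by positivity
  rw [scale, mul_assoc, ← Real.rpow_add_one hN0, sub_add_cancel]

theorem scale_pos {α : ℝ} {φ : ℕ → ℝ} {N : ℕ} (hN : 1 ≤ N) (hφ : 0 < φ N) : 0 < scale α φ N := by
  have : (0 : ℝ) < N := by exact_mod_cast hN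
  unfold scale; positivity

/-- The inner sum only involves the finitely many displacements `p = n - m` that the expansion
property of level powers allows. -/
theorem innerSum_eq {α : ℝ} (h0 : 0 < α) (h1 : α < 1) {L : Submodule ℤ ℂ} [DiscreteTopology L]
    {z₀ : ℂ} {f : ℂ → ℂ} {R : ℝ} (hR : ∀ z, R < ‖z‖ → f z = 0) {φ : ℕ → ℝ} {N : ℕ} (hN : 1 ≤ N)
    (hφ : 0 < φ N) (k : ℤ) {n : ℂ} (hn : n ∈ gridBall L z₀ N) :
    innerSum α L z₀ f (φ N) N k n = ∑ p ∈ latticeBall L (R / (α * scale α φ N)),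
      if n - p ∈ gridBall L z₀ N then f (φ N * (levelPow α k n - levelPow α k (n - p))) else 0 := by
  have hs := scale_pos (α := α) hN hφ
  obtain ⟨hnL, hn0, hnN⟩ := mem_gridBall.1 hn
  rw [← Finset.sum_filter, innerSum,
    ← Finset.sum_image (s := {p ∈ latticeBall L (R / (α * scale α φ N)) | n - p ∈ gridBall L z₀ N})
      (g := fun p => n - p) (f := fun m => f (φ N * (levelPow α k n - levelPow α k m)))
      (fun a _ b _ h => sub_right_injective h)]
  symm
  refine Finset.sum_subset ?_ ?_
  · intro m hm
    simp only [Finset.mem_image, Finset.mem_filter] at hm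
    obtain ⟨p, ⟨hp, hpG⟩, rfl⟩ := hm
    refine Finset.mem_erase.2 ⟨fun h => (mem_latticeBall.1 hp).1 ?_, hpG⟩
    linear_combination -h
  · intro m hm hm'
    by_contra hne
    refine hm' (Finset.mem_image.2 ⟨n - m, ?_, sub_sub_cancel n m⟩)
    obtain ⟨hmn, hmG⟩ := Finset.mem_erase.1 hm
    obtain ⟨hmL, hm0, hmN⟩ := mem_gridBall.1 hmG
    refine Finset.mem_filter.2 ⟨mem_latticeBall.2 ⟨sub_ne_zero.2 (Ne.symm hmn), ?_, ?_⟩,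
      by rwa [sub_sub_cancel]⟩
    · convert L.sub_mem hnL hmL using 1; ring
    · have hle : ‖(φ N : ℂ) * (levelPow α k n - levelPow α k m)‖ ≤ R := by
        by_contra h
        exact hne (hR _ (not_le.1 h))
      rw [norm_mul, Complex.norm_real, Real.norm_of_nonneg hφ.le] at hle
      have hlow := le_norm_levelPow_sub h0 h1 k (norm_pos_iff.1 hn0) (norm_pos_iff.1 hm0) hnN hmN
      rw [le_div_iff₀ (by positivity), scale]
      calc ‖n - m‖ * (α * (φ N * (N : ℝ) ^ (α - 1)))
          = φ N * (α * (N : ℝ) ^ (α - 1) * ‖n - m‖) := by ring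
        _ ≤ φ N * ‖levelPow α k n - levelPow α k m‖ := by gcongr
        _ ≤ R := hle

theorem sq_mul_card_latticeBall_le {L : Submodule ℤ ℂ} [DiscreteTopology L] {B : ℝ}
    (hB : ∀ r, ((latticeBall L r).card : ℝ) ≤ B * r ^ 2) {α s : ℝ} (hα : 0 < α) (hs : 0 < s)
    (R : ℝ) : s ^ 2 * ((latticeBall L (R / (α * s))).card : ℝ) ≤ B * (R / α) ^ 2 := by
  calc s ^ 2 * ((latticeBall L (R / (α * s))).card : ℝ) ≤ s ^ 2 * (B * (R / (α * s)) ^ 2) := by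
        gcongr; exact hB _
    _ = B * (R / α) ^ 2 := by field_simp

theorem norm_sq_mul_innerSum_le {α : ℝ} (h0 : 0 < α) (h1 : α < 1) {L : Submodule ℤ ℂ}
    [DiscreteTopology L] {B : ℝ} (hB : ∀ r, ((latticeBall L r).card : ℝ) ≤ B * r ^ 2)
    {z₀ : ℂ} {f : ℂ → ℂ} {R K : ℝ} (hR : ∀ z, R < ‖z‖ → f z = 0) (hK : ∀ z, ‖f z‖ ≤ K)
    {φ : ℕ → ℝ} {N : ℕ} (hN : 1 ≤ N)
    (hφ : 0 < φ N) (k : ℤ) {n : ℂ} (hn : n ∈ gridBall L z₀ N) :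
    ‖((scale α φ N ^ 2 : ℝ) : ℂ) * innerSum α L z₀ f (φ N) N k n‖ ≤ B * (R / α) ^ 2 * K := by
  have hs := scale_pos (α := α) hN hφ
  have hK0 : 0 ≤ K := (norm_nonneg _).trans (hK 0)
  rw [innerSum_eq h0 h1 hR hN hφ k hn, norm_mul, Complex.norm_real, Real.norm_of_nonneg (by positivity)]
  refine le_trans ?_ (mul_le_mul_of_nonneg_right (sq_mul_card_latticeBall_le hB h0 hs R) hK0)
  rw [mul_assoc]
  gcongr
  rw [← nsmul_eq_mul]
  refine (norm_sum_le_of_le _ fun p _ => ?_).trans_eq (Finset.sum_const _)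
  split_ifs
  · exact hK _
  · simpa using hK0

/-! ### Linearization -/

/-- The normalized sum `s² ∑ f (α s p w)` over the nonzero lattice points `p`. The sum is restricted
to `‖p‖ ≤ R / (α s)`, which loses nothing if `‖w‖ ≥ 1` and `f` vanishes off the ball of radius `R`. -/
noncomputable def latticeSum (L : Submodule ℤ ℂ) [DiscreteTopology L] (α R : ℝ) (f : ℂ → ℂ)
    (s : ℝ) (w : ℂ) : ℂ :=
  ((s ^ 2 : ℝ) : ℂ) * ∑ p ∈ latticeBall L (R / (α * s)), f (((α * s : ℝ) : ℂ) * p * w)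

theorem norm_latticeSum_le {L : Submodule ℤ ℂ}
    [DiscreteTopology L] {B : ℝ} (hB : ∀ r, ((latticeBall L r).card : ℝ) ≤ B * r ^ 2)
    {f : ℂ → ℂ} {K : ℝ} (hK : ∀ z, ‖f z‖ ≤ K) {α s : ℝ} (hα : 0 < α) (hs : 0 < s) (R : ℝ) (w : ℂ) :
    ‖latticeSum L α R f s w‖ ≤ B * (R / α) ^ 2 * K := by
  have hK0 : 0 ≤ K := (norm_nonneg _).trans (hK 0)
  rw [latticeSum, norm_mul, Complex.norm_real, Real.norm_of_nonneg (by positivity)]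
  refine le_trans ?_ (mul_le_mul_of_nonneg_right (sq_mul_card_latticeBall_le hB hα hs R) hK0)
  rw [mul_assoc]
  gcongr
  rw [← nsmul_eq_mul]
  exact (norm_sum_le_of_le _ fun p _ => hK _).trans_eq (Finset.sum_const _)

/-- The phases relating the levels of the power of exponent `α` and of its derivative agree. -/
theorem exp_level_phase_sub_one (α : ℝ) (k : ℤ) :
    Complex.exp (((α - 1) * (2 * Real.pi * k) : ℝ) * Complex.I)
      = Complex.exp ((α * (2 * Real.pi * k) : ℝ) * Complex.I) := by
  rw [Complex.exp_eq_exp_iff_exists_int]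
  exact ⟨-k, by push_cast; ring⟩

/-- At a point off the cut, the inner sum at the nearby grid point of `N x` is asymptotic to the
lattice sum at the derivative of the level power, uniformly in the level: the relevant displacements
are `O(N / (φ(N) N ^ α))`, hence negligible with respect to `N`. -/
theorem eventually_norm_innerSum_sub_latticeSum_le {α : ℝ} (h0 : 0 < α) (h1 : α < 1)
    {L : Submodule ℤ ℂ} [DiscreteTopology L] [IsZLattice ℝ L] (z₀ : ℂ) {f : ℂ → ℂ}
    (hf : Continuous f) (hfc : HasCompactSupport f) {R : ℝ} (hR0 : 0 < R)
    (hR : ∀ z, R < ‖z‖ → f z = 0) {φ : ℕ → ℝ} (hφ_pos : ∀ N : ℕ, 1 ≤ N → 0 < φ N)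
    (hφ_top : Tendsto φ atTop atTop) {x : ℂ} (hx : -x ∈ Complex.slitPlane) (hx1 : ‖x‖ < 1)
    {ε : ℝ} (hε : 0 < ε) :
    ∀ᶠ N : ℕ in atTop, ∀ k : ℤ,
      ‖((scale α φ N ^ 2 : ℝ) : ℂ) * cellFun L z₀ (gridBall L z₀ N)
          (innerSum α L z₀ f (φ N) N k) (N * x)
        - latticeSum L α R f (scale α φ N) (levelPow (α - 1) k x)‖ ≤ ε := by
  obtain ⟨C, hC, hdist⟩ := exists_norm_gridPoint_sub_le L
  obtain ⟨B, hB0, hB⟩ := exists_card_latticeBall_le L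
  -- `B * (R / α) ^ 2` bounds the square of the scale times the number of terms
  set ε₁ := ε / (B * (R / α) ^ 2) with hε₁
  have hε₁0 : 0 < ε₁ := by positivity
  obtain ⟨δ, hδ, huc⟩ := Metric.uniformContinuous_iff.1
    (hfc.uniformContinuous_of_continuous hf) ε₁ hε₁0
  have hx0 : 0 < ‖x‖ := by
    rw [← norm_neg]; exact norm_pos_iff.2 (Complex.slitPlane_ne_zero hx)
  -- strict differentiability near `x` with relative error `η`: as the scale times `‖p‖` is at most
  -- `R / α`, the arguments of `f` then move by at most `δ / 2`
  set η := δ * α / (2 * R) with hη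
  have hη0 : 0 < η := by positivity
  have hder := (hasStrictDerivAt_levelPow_zero α hx).isLittleO.def hη0
  obtain ⟨ρ₀, hρ₀, hder⟩ := Metric.eventually_nhds_iff.1 hder
  -- the ball of radius `ρ` around `x` stays in the punctured unit disc, so the condition on the
  -- modulus of the second point of a pair is automatic
  set ρ := min ρ₀ (min ‖x‖ (1 - ‖x‖)) with hρdef
  have hρ : 0 < ρ := lt_min hρ₀ (lt_min hx0 (sub_pos.2 hx1))
  have hball : ∀ u : ℂ, ‖u - x‖ < ρ → 0 < ‖u‖ ∧ ‖u‖ < 1 := by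
    intro u hu
    have h2 : ρ ≤ ‖x‖ := (min_le_right _ _).trans (min_le_left _ _)
    have h3 : ρ ≤ 1 - ‖x‖ := (min_le_right _ _).trans (min_le_right _ _)
    have h4 := norm_sub_norm_le x u
    rw [norm_sub_rev] at h4
    have h5 := norm_sub_norm_le u x
    constructor <;> linarith
  have ev1 : ∀ᶠ N : ℕ in atTop, C / (N : ℝ) < ρ / 2 :=
    (tendsto_const_nhds.div_atTop tendsto_natCast_atTop_atTop).eventually_lt_const (by positivity)
  have ev2 : ∀ᶠ N : ℕ in atTop, R / α / (φ N * (N : ℝ) ^ α) < ρ / 2 :=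
    (tendsto_const_nhds.div_atTop (hφ_top.atTop_mul_atTop₀
      ((tendsto_rpow_atTop h0).comp tendsto_natCast_atTop_atTop))).eventually_lt_const
      (by positivity)
  filter_upwards [ev1, ev2, eventually_ge_atTop 1] with N hN1 hN2 hN k
  have hφ := hφ_pos N hN
  set s := scale α φ N with hsdef
  have hs : 0 < s := scale_pos hN hφ
  have hNpos : (0 : ℝ) < N := by exact_mod_cast hN
  have hNc : (N : ℂ) ≠ 0 := by exact_mod_cast hNpos.ne'
  have hsN : s * N = φ N * (N : ℝ) ^ α := scale_mul_natCast α φ hN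
  set n := gridPoint L z₀ (N * x) with hn
  set u : ℂ := n / N with hu
  have hnu : n = N * u := by rw [hu]; field_simp
  have hux : ‖u - x‖ < ρ / 2 := by
    have e : u - x = (n - N * x) / N := by rw [hu]; field_simp
    rw [e, norm_div, Complex.norm_natCast]
    exact lt_of_le_of_lt (by gcongr; exact hdist _ _) hN1
  have hmem : ∀ v : ℂ, ‖v - x‖ < ρ → N * v - z₀ ∈ L → (N : ℂ) * v ∈ gridBall L z₀ N := by
    intro v hv hvL
    obtain ⟨hv0, hv1⟩ := hball v hv
    refine mem_gridBall.2 ⟨hvL, ?_, ?_⟩ <;> rw [norm_mul, Complex.norm_natCast]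
    · positivity
    · exact mul_le_of_le_one_right hNpos.le hv1.le
  have hnL : n - z₀ ∈ L := gridPoint_sub_mem L z₀ _
  have hnG : n ∈ gridBall L z₀ N := by
    rw [hnu]; exact hmem u (by linarith) (by rwa [← hnu])
  have hcell : cellFun L z₀ (gridBall L z₀ N) (innerSum α L z₀ f (φ N) N k) (N * x)
      = innerSum α L z₀ f (φ N) N k n := by
    rw [cellFun, if_pos hnG]
  have hterm : ∀ p ∈ latticeBall L (R / (α * s)),
      ‖(if n - p ∈ gridBall L z₀ N then f (φ N * (levelPow α k n - levelPow α k (n - p))) else 0)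
        - f (((α * s : ℝ) : ℂ) * p * levelPow (α - 1) k x)‖ ≤ ε₁ := by
    intro p hp
    obtain ⟨hp0, hpL, hpn⟩ := mem_latticeBall.1 hp
    set v : ℂ := u - p / N with hv
    have hnv : n - p = N * v := by rw [hv, hu]; field_simp
    have hpN : ‖p / (N : ℂ)‖ < ρ / 2 := by
      rw [norm_div, Complex.norm_natCast]
      refine lt_of_le_of_lt ?_ hN2
      rw [← hsN, div_le_iff₀ hNpos]
      refine hpn.trans (le_of_eq ?_)
      field_simp
    have hvx : ‖v - x‖ < ρ := by
      calc ‖v - x‖ = ‖(u - x) - p / N‖ := by rw [hv]; ring_nf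
        _ ≤ ‖u - x‖ + ‖p / (N : ℂ)‖ := norm_sub_le _ _
        _ < ρ := by linarith
    have hG : n - p ∈ gridBall L z₀ N := by
      rw [hnv]
      refine hmem v hvx ?_
      rw [← hnv]
      convert L.sub_mem hnL hpL using 1; ring
    rw [if_pos hG, ← dist_eq_norm]
    refine (huc ?_).le
    have hρρ : ρ ≤ ρ₀ := min_le_left _ _
    have hd := hder (y := (u, v)) (by
      rw [Prod.dist_eq, max_lt_iff, dist_eq_norm, dist_eq_norm]
      exact ⟨by linarith, by linarith⟩)
    have huv : u - v = p / N := by rw [hv]; ring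
    simp only [ContinuousLinearMap.toSpanSingleton_apply, smul_eq_mul, huv] at hd
    rw [dist_eq_norm, hnu, show (N : ℂ) * u - p = N * v by rw [← hnu, hnv]]
    have hNr : (N : ℂ) = ((N : ℝ) : ℂ) := by push_cast; rfl
    rw [hNr, levelPow_real_mul α k hNpos, levelPow_real_mul α k hNpos,
      levelPow_eq_phase_mul α k u, levelPow_eq_phase_mul α k v, levelPow_eq_phase_mul (α - 1) k x,
      exp_level_phase_sub_one]
    set c := Complex.exp ((α * (2 * Real.pi * k) : ℝ) * Complex.I) with hc
    have hcn : ‖c‖ = 1 := Complex.norm_exp_ofReal_mul_I _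
    have hsNc : (s : ℂ) * N = φ N * ((N : ℝ) ^ α : ℝ) := by exact_mod_cast hsN
    have e : (φ N : ℂ) * ((((N : ℝ) ^ α : ℝ) : ℂ) * (c * levelPow α 0 u)
          - (((N : ℝ) ^ α : ℝ) : ℂ) * (c * levelPow α 0 v))
        - ((α * s : ℝ) : ℂ) * p * (c * levelPow (α - 1) 0 x)
        = c * (s * N) * (levelPow α 0 u - levelPow α 0 v
            - p / N * (α * levelPow (α - 1) 0 x)) := by
      have e1 : ((α * s : ℝ) : ℂ) * p * (c * levelPow (α - 1) 0 x)
          = c * (s * N) * (p / N * (α * levelPow (α - 1) 0 x)) := by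
        push_cast; field_simp
      rw [e1, hsNc]; ring
    rw [e, norm_mul, norm_mul, hcn, one_mul, norm_mul, Complex.norm_real, Complex.norm_natCast,
      Real.norm_of_nonneg hs.le]
    calc s * N * ‖levelPow α 0 u - levelPow α 0 v - p / N * (α * levelPow (α - 1) 0 x)‖
        ≤ s * N * (η * ‖p / (N : ℂ)‖) := by gcongr
      _ = η * (s * ‖p‖) := by
          rw [norm_div, Complex.norm_natCast]; clear_value s; field_simp
      _ ≤ η * (s * (R / (α * s))) := by gcongr
      _ = δ / 2 := by rw [hη]; clear_value s; field_simp
      _ < δ := by linarith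
  rw [hcell, innerSum_eq h0 h1 hR hN hφ k hnG, latticeSum, ← mul_sub, ← Finset.sum_sub_distrib,
    norm_mul, Complex.norm_real, Real.norm_of_nonneg (by positivity)]
  calc s ^ 2 * ‖∑ p ∈ latticeBall L (R / (α * s)),
        ((if n - p ∈ gridBall L z₀ N then f (φ N * (levelPow α k n - levelPow α k (n - p))) else 0)
          - f (((α * s : ℝ) : ℂ) * p * levelPow (α - 1) k x))‖
      ≤ s ^ 2 * ((latticeBall L (R / (α * s))).card * ε₁) := by
        gcongr
        rw [← nsmul_eq_mul]
        exact (norm_sum_le_of_le _ hterm).trans_eq (Finset.sum_const _)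
    _ = s ^ 2 * (latticeBall L (R / (α * s))).card * ε₁ := by ring
    _ ≤ B * (R / α) ^ 2 * ε₁ :=
        mul_le_mul_of_nonneg_right (sq_mul_card_latticeBall_le hB h0 hs R) hε₁0.le
    _ = ε := by rw [hε₁]; exact mul_div_cancel₀ _ (by positivity)

/-- Outside the unit disc the step functions vanish eventually. -/
theorem eventually_cellFun_gridBall_eq_zero (L : Submodule ℤ ℂ) [DiscreteTopology L]
    [IsZLattice ℝ L] (z₀ : ℂ) {x : ℂ} (hx : 1 < ‖x‖) :
    ∀ᶠ N : ℕ in atTop, ∀ h : ℂ → ℂ, cellFun L z₀ (gridBall L z₀ N) h (N * x) = 0 := by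
  obtain ⟨C, hC, hdist⟩ := exists_norm_gridPoint_sub_le L
  have ev1 : ∀ᶠ N : ℕ in atTop, C < N * (‖x‖ - 1) :=
    (tendsto_natCast_atTop_atTop.atTop_mul_const (sub_pos.2 hx)).eventually_gt_atTop C
  filter_upwards [ev1] with N hN h
  rw [cellFun, if_neg]
  intro hmem
  have h1 := (mem_gridBall.1 hmem).2.2
  have h2 := hdist z₀ (N * x)
  have h3 := norm_sub_norm_le ((N : ℂ) * x) (gridPoint L z₀ (N * x))
  rw [norm_sub_rev, norm_mul, Complex.norm_natCast] at h3
  linarith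

/-! ### Averaging over the levels -/

/-- The average over the levels `-N' ≤ k < N''`. -/
noncomputable def levelAverage (N' N'' : ℕ) (a : ℤ → ℂ) : ℂ :=
  ((1 / ((N' : ℝ) + N'') : ℝ) : ℂ) * ∑ k ∈ Finset.Ico (-(N' : ℤ)) (N'' : ℤ), a k

theorem norm_levelAverage_le {N' N'' : ℕ} {a : ℤ → ℂ} {A : ℝ} (hA : 0 ≤ A) (ha : ∀ k, ‖a k‖ ≤ A) :
    ‖levelAverage N' N'' a‖ ≤ A := by
  rw [levelAverage, norm_mul, Complex.norm_real, Real.norm_of_nonneg (by positivity)]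
  have h1 : ‖∑ k ∈ Finset.Ico (-(N' : ℤ)) (N'' : ℤ), a k‖ ≤ ((N' : ℝ) + N'') * A := by
    refine (norm_sum_le_of_le _ fun k _ => ha k).trans_eq ?_
    rw [Finset.sum_const, Int.card_Ico, nsmul_eq_mul]
    congr 1
    rw [show ((N'' : ℤ) - -(N' : ℤ)).toNat = N' + N'' by omega]
    push_cast; rfl
  rw [div_mul_eq_mul_div, one_mul]
  refine div_le_of_le_mul₀ (by positivity) hA (h1.trans_eq (mul_comm _ _))

theorem levelAverage_sub (N' N'' : ℕ) (a b : ℤ → ℂ) :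
    levelAverage N' N'' a - levelAverage N' N'' b = levelAverage N' N'' fun k => a k - b k := by
  simp only [levelAverage, Finset.sum_sub_distrib, mul_sub]

/-- The rescaled pair sum, as a step function of the first point of the pair. -/
noncomputable def pairStep (α : ℝ) (L : Submodule ℤ ℂ) [DiscreteTopology L] [IsZLattice ℝ L]
    (z₀ : ℂ) (f : ℂ → ℂ) (φ : ℕ → ℝ) (t : ℕ × ℕ × ℕ) (x : ℂ) : ℂ :=
  levelAverage t.2.1 t.2.2 fun k => ((scale α φ t.1 ^ 2 : ℝ) : ℂ) *
    cellFun L z₀ (gridBall L z₀ t.1) (innerSum α L z₀ f (φ t.1) t.1 k) (t.1 * x)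

/-- The linearized counterpart of `pairStep`: the difference of the level powers of `n` and `n - p` is
replaced by `α p` times the level-`k` power of exponent `α - 1` at `x`. -/
noncomputable def pairLinear (α : ℝ) (L : Submodule ℤ ℂ) [DiscreteTopology L]
    (R : ℝ) (f : ℂ → ℂ) (φ : ℕ → ℝ) (t : ℕ × ℕ × ℕ) : ℂ → ℂ :=
  Set.indicator (Metric.closedBall 0 1) fun x =>
    levelAverage t.2.1 t.2.2 fun k =>
      latticeSum L α R f (scale α φ t.1) (levelPow (α - 1) k x)

theorem continuous_latticeSum (L : Submodule ℤ ℂ) [DiscreteTopology L] (α R : ℝ) {f : ℂ → ℂ}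
    (hf : Continuous f) (s : ℝ) : Continuous (latticeSum L α R f s) := by
  unfold latticeSum; fun_prop

theorem measurable_pairLinear {α : ℝ} {L : Submodule ℤ ℂ} [DiscreteTopology L] {f : ℂ → ℂ}
    {φ : ℕ → ℝ} (hf : Continuous f) (R : ℝ) (t : ℕ × ℕ × ℕ) :
    Measurable (pairLinear α L R f φ t) := by
  have h := (continuous_latticeSum L α R hf (scale α φ t.1)).measurable
  have h' := fun k => measurable_levelPow (α - 1) k
  unfold pairLinear levelAverage
  refine Measurable.indicator ?_ Metric.isClosed_closedBall.measurableSet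
  fun_prop

section

variable {α : ℝ} {L : Submodule ℤ ℂ} [DiscreteTopology L] [IsZLattice ℝ L] {z₀ : ℂ} {f : ℂ → ℂ}
  {φ ψ : ℕ → ℝ}

theorem measurable_pairStep (t : ℕ × ℕ × ℕ) : Measurable (pairStep α L z₀ f φ t) := by
  have h : ∀ k, Measurable (cellFun L z₀ (gridBall L z₀ t.1)
      (innerSum α L z₀ f (φ t.1) t.1 k)) := fun k =>
    measurable_cellFun L (fun n hn => (mem_gridBall.1 hn).1) _
  unfold pairStep levelAverage
  fun_prop

theorem integral_eq_integral_pairStep {Λ : Set ℂ} (hΛ : Λ = {w : ℂ | ∃ p ∈ L, w = z₀ + p})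
    (hφ_pos : ∀ N : ℕ, 1 ≤ N → 0 < φ N)
    (hψ : ∀ N : ℕ, 1 ≤ N → ψ N = ((N : ℝ) ^ (2 - α) / φ N) ^ 2)
    {t : ℕ × ℕ × ℕ} (ht : 1 ≤ t.1) :
    ∫ z, f z ∂(levelPairCorrelation α Λ φ ψ t.1 t.2.1 t.2.2)
      = ((ZLattice.covolume L : ℝ) : ℂ)⁻¹ * ∫ x, pairStep α L z₀ f φ t x := by
  obtain ⟨N, N', N''⟩ := t
  simp only at ht ⊢
  have hN : (0 : ℝ) < N := by exact_mod_cast ht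
  have hφ := hφ_pos N ht
  have hcov : 0 < ZLattice.covolume L := ZLattice.covolume_pos L _
  have hS : ∀ n ∈ gridBall L z₀ N, n - z₀ ∈ L := fun n hn => (mem_gridBall.1 hn).1
  have hint : ∀ k, Integrable fun x : ℂ => cellFun L z₀ (gridBall L z₀ N)
      (innerSum α L z₀ f (φ N) N k) (N * x) := by
    intro k
    have := (integrable_cellFun L hS (innerSum α L z₀ f (φ N) N k)).comp_smul hN.ne'
    simpa using this
  have hval : ∀ k, ∫ x : ℂ, cellFun L z₀ (gridBall L z₀ N)
      (innerSum α L z₀ f (φ N) N k) (N * x)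
      = ((1 / N ^ 2 : ℝ) : ℂ) * (ZLattice.covolume L * ∑ n ∈ gridBall L z₀ N,
        innerSum α L z₀ f (φ N) N k n) := by
    intro k
    have := Measure.integral_comp_smul (volume : Measure ℂ) (cellFun L z₀ (gridBall L z₀ N)
      (innerSum α L z₀ f (φ N) N k)) (N : ℝ)
    rw [integral_cellFun L hS, Complex.finrank_real_complex, abs_of_pos (by positivity)] at this
    simp only [Complex.real_smul, Complex.ofReal_natCast] at this
    rw [this, one_div]
  rw [integral_levelPairCorrelation hΛ α φ ψ N' N'' (by rw [hψ N ht]; positivity)]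
  simp only [pairStep, levelAverage]
  rw [integral_const_mul, integral_finsetSum _ fun k _ => (hint k).const_mul _]
  simp_rw [integral_const_mul, hval]
  have hs : (1 : ℝ) / ψ N = scale α φ N ^ 2 / N ^ 2 := by
    rw [hψ N ht, scale, Real.rpow_sub hN, Real.rpow_sub hN, Real.rpow_one, Real.rpow_two]
    have : (0 : ℝ) < (N : ℝ) ^ α := by positivity
    field_simp
  have hsc : ((1 / (((N' : ℝ) + N'') * ψ N) : ℝ) : ℂ)
      = ((1 / ((N' : ℝ) + N'') : ℝ) : ℂ) * ((scale α φ N ^ 2 / N ^ 2 : ℝ) : ℂ) := by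
    rw [← hs, ← Complex.ofReal_mul]; congr 1
    rw [div_mul_div_comm, one_mul]
  rw [hsc, mul_left_comm, mul_assoc]
  congr 1
  rw [Finset.mul_sum, Finset.mul_sum]
  refine Finset.sum_congr rfl fun k _ => ?_
  have hc : ((ZLattice.covolume L : ℝ) : ℂ) ≠ 0 := by exact_mod_cast hcov.ne'
  have hNc : (N : ℂ) ≠ 0 := by exact_mod_cast hN.ne'
  push_cast
  field_simp

theorem tendsto_fst_comap :
    Tendsto (fun t : ℕ × ℕ × ℕ => t.1)
      (comap (fun t : ℕ × ℕ × ℕ => min t.1 (t.2.1 + t.2.2)) atTop) atTop :=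
  tendsto_atTop_mono (fun _ => min_le_left _ _) tendsto_comap

theorem tendsto_levels_comap :
    Tendsto (fun t : ℕ × ℕ × ℕ => t.2.1 + t.2.2)
      (comap (fun t : ℕ × ℕ × ℕ => min t.1 (t.2.1 + t.2.2)) atTop) atTop :=
  tendsto_atTop_mono (fun _ => min_le_right _ _) tendsto_comap

theorem ae_neg_mem_slitPlane : ∀ᵐ x : ℂ, -x ∈ Complex.slitPlane := by
  have h : volume (LinearMap.ker Complex.imLm : Set ℂ) = 0 := by
    refine Measure.addHaar_submodule _ _ fun h => ?_
    have : Complex.I ∈ LinearMap.ker Complex.imLm := h ▸ Submodule.mem_top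
    simp at this
  refine measure_mono_null (fun x hx => ?_) h
  simp only [SetLike.mem_coe, LinearMap.mem_ker, Complex.imLm_coe]
  by_contra h'
  exact hx (Complex.mem_slitPlane_iff.2 (Or.inr (by simpa using h')))

/-- Replacing the differences of level powers by their linearization does not change the limit. -/
theorem tendsto_integral_pairStep_sub_pairLinear (h0 : 0 < α) (h1 : α < 1)
    (hf : Continuous f) (hfc : HasCompactSupport f) {R K : ℝ} (hR0 : 0 < R)
    (hR : ∀ z, R < ‖z‖ → f z = 0) (hK : ∀ z, ‖f z‖ ≤ K) (hφ_pos : ∀ N : ℕ, 1 ≤ N → 0 < φ N)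
    (hφ_top : Tendsto φ atTop atTop) :
    Tendsto (fun t => (∫ x, pairStep α L z₀ f φ t x) - ∫ x, pairLinear α L R f φ t x)
      (comap (fun t : ℕ × ℕ × ℕ => min t.1 (t.2.1 + t.2.2)) atTop) (𝓝 0) := by
  obtain ⟨C, hC, hdist⟩ := exists_norm_gridPoint_sub_le L
  obtain ⟨B, hB0, hB⟩ := exists_card_latticeBall_le L
  have hK0 : 0 ≤ K := (norm_nonneg _).trans (hK 0)
  set A := B * (R / α) ^ 2 * K with hA
  have hA0 : 0 ≤ A := by positivity
  have ev1 := tendsto_fst_comap.eventually (eventually_ge_atTop 1)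
  -- a common integrable bound: grid points of modulus at most `N` have cells in the ball of radius
  -- `N + C`
  set bd : ℂ → ℝ := Set.indicator (Metric.closedBall 0 (1 + C)) fun _ => A with hbd
  have hbdi : Integrable bd := by
    rw [hbd, integrable_indicator_iff Metric.isClosed_closedBall.measurableSet]
    exact integrableOn_const (measure_closedBall_lt_top.ne)
  have hbd0 : ∀ x, 0 ≤ bd x := fun x => Set.indicator_nonneg (fun _ _ => hA0) x
  have b1 : ∀ t : ℕ × ℕ × ℕ, 1 ≤ t.1 → ∀ x, ‖pairStep α L z₀ f φ t x‖ ≤ bd x := by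
    rintro ⟨N, N', N''⟩ hN x
    simp only at hN
    have hN0 : (1 : ℝ) ≤ N := by exact_mod_cast hN
    refine norm_levelAverage_le (hbd0 x) fun k => ?_
    simp only [cellFun]
    split_ifs with hG
    · have hx : x ∈ Metric.closedBall (0 : ℂ) (1 + C) := by
        rw [mem_closedBall_zero_iff]
        have h2 := (mem_gridBall.1 hG).2.2
        have h3 := hdist z₀ (N * x)
        have h4 := norm_sub_norm_le ((N : ℂ) * x) (gridPoint L z₀ (N * x))
        rw [norm_sub_rev, norm_mul, Complex.norm_natCast] at h4
        nlinarith
      rw [hbd, Set.indicator_of_mem hx]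
      exact norm_sq_mul_innerSum_le h0 h1 hB hR hK hN (hφ_pos N hN) k hG
    · simpa using hbd0 x
  have b2 : ∀ t : ℕ × ℕ × ℕ, 1 ≤ t.1 → ∀ x, ‖pairLinear α L R f φ t x‖ ≤ bd x := by
    rintro ⟨N, N', N''⟩ hN x
    simp only at hN
    rw [pairLinear]
    by_cases hx : x ∈ Metric.closedBall (0 : ℂ) 1
    · rw [Set.indicator_of_mem hx, hbd,
        Set.indicator_of_mem (Metric.closedBall_subset_closedBall (by linarith) hx)]
      exact norm_levelAverage_le hA0 fun k =>
        norm_latticeSum_le hB hK h0 (scale_pos hN (hφ_pos N hN)) R _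
    · rw [Set.indicator_of_notMem hx, norm_zero]; exact hbd0 x
  have key : Tendsto (fun t => ∫ x, (pairStep α L z₀ f φ t x - pairLinear α L R f φ t x))
      (comap (fun t : ℕ × ℕ × ℕ => min t.1 (t.2.1 + t.2.2)) atTop) (𝓝 (∫ _ : ℂ, (0 : ℂ))) := by
    refine tendsto_integral_filter_of_dominated_convergence (fun x => bd x + bd x) ?_ ?_
      (hbdi.add hbdi) ?_
    · exact Eventually.of_forall fun t =>
        ((measurable_pairStep t).sub (measurable_pairLinear hf R t)).aestronglyMeasurable
    · filter_upwards [ev1] with t ht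
      exact Eventually.of_forall fun x =>
        (norm_sub_le _ _).trans (add_le_add (b1 t ht x) (b2 t ht x))
    · have hsph : ∀ᵐ x : ℂ, ‖x‖ ≠ 1 := by
        have := Measure.addHaar_sphere (volume : Measure ℂ) 0 1
        refine measure_mono_null (fun x hx => ?_) this
        rw [mem_sphere_zero_iff_norm]
        exact not_not.1 hx
      filter_upwards [ae_neg_mem_slitPlane, hsph] with x hx hx1
      rcases lt_or_gt_of_ne hx1 with hlt | hgt
      · rw [Metric.tendsto_nhds]
        intro ε hε
        have ev := tendsto_fst_comap.eventually
          (eventually_norm_innerSum_sub_latticeSum_le h0 h1 (L := L) z₀ hf hfc hR0 hR hφ_pos hφ_top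
            hx hlt (half_pos hε))
        filter_upwards [ev] with t ht
        rw [dist_zero_right, pairLinear,
          Set.indicator_of_mem (mem_closedBall_zero_iff.2 hlt.le), pairStep, levelAverage_sub]
        exact (norm_levelAverage_le (half_pos hε).le ht).trans_lt (half_lt_self hε)
      · have ev := tendsto_fst_comap.eventually (eventually_cellFun_gridBall_eq_zero L z₀ hgt)
        refine tendsto_const_nhds.congr' ?_
        filter_upwards [ev] with t ht
        have : x ∉ Metric.closedBall (0 : ℂ) 1 := by
          rw [mem_closedBall_zero_iff]; exact not_le.2 hgt
        rw [pairLinear, Set.indicator_of_notMem this]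
        simp [pairStep, ht, levelAverage]
  rw [integral_zero] at key
  refine key.congr' ?_
  filter_upwards [ev1] with t ht
  refine integral_sub ?_ ?_
  · exact hbdi.mono' (measurable_pairStep t).aestronglyMeasurable
      (Eventually.of_forall (b1 t ht))
  · exact hbdi.mono' (measurable_pairLinear hf R t).aestronglyMeasurable
      (Eventually.of_forall (b2 t ht))

end

/-- The integral of `latticeSum` over the circle of radius `ρ`, with respect to the angle. -/
noncomputable def radialSum (L : Submodule ℤ ℂ) [DiscreteTopology L] (α R : ℝ) (f : ℂ → ℂ)
    (s ρ : ℝ) : ℂ :=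
  ((s ^ 2 : ℝ) : ℂ) * ∑ p ∈ latticeBall L (R / (α * s)), circleInt f (α * s * ‖p‖ * ρ)

section

variable {α : ℝ} {L : Submodule ℤ ℂ} [DiscreteTopology L] {f : ℂ → ℂ}

theorem integral_latticeSum_circle (hf : Continuous f) (R : ℝ) (hα : 0 < α) {s : ℝ}
    (hs : 0 < s) {ρ : ℝ} (hρ : 0 ≤ ρ) :
    ∫ θ in (0 : ℝ)..2 * Real.pi, latticeSum L α R f s (ρ * Complex.exp (θ * Complex.I))
      = radialSum L α R f s ρ := by
  simp only [latticeSum, radialSum]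
  rw [intervalIntegral.integral_const_mul, intervalIntegral.integral_finsetSum
    (fun p _ => Continuous.intervalIntegrable (by fun_prop) _ _)]
  congr 1
  refine Finset.sum_congr rfl fun p _ => ?_
  simp_rw [← mul_assoc]
  rw [integral_circle_eq_circleInt]
  simp only [norm_mul, Complex.norm_real, Real.norm_of_nonneg hρ,
    Real.norm_of_nonneg hα.le, Real.norm_of_nonneg hs.le]

theorem continuous_radialSum (hf : Continuous f) (R s : ℝ) :
    Continuous (radialSum L α R f s) := by
  have := continuous_circleInt hf
  unfold radialSum; fun_prop

theorem norm_radialSum_le {B : ℝ} (hB : ∀ r, ((latticeBall L r).card : ℝ) ≤ B * r ^ 2) {K : ℝ}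
    (hK : ∀ z, ‖f z‖ ≤ K) {s : ℝ} (hα : 0 < α) (hs : 0 < s) (R ρ : ℝ) :
    ‖radialSum L α R f s ρ‖ ≤ B * (R / α) ^ 2 * (2 * Real.pi * K) := by
  have hK0 : 0 ≤ K := (norm_nonneg _).trans (hK 0)
  rw [radialSum, norm_mul, Complex.norm_real, Real.norm_of_nonneg (by positivity)]
  refine le_trans ?_ (mul_le_mul_of_nonneg_right (sq_mul_card_latticeBall_le hB hα hs R)
    (by positivity))
  rw [mul_assoc]
  gcongr
  rw [← nsmul_eq_mul]
  exact (norm_sum_le_of_le _ fun p _ => norm_circleInt_le hK _).trans_eq (Finset.sum_const _)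

theorem integrable_pairLinear {B : ℝ} (hB : ∀ r, ((latticeBall L r).card : ℝ) ≤ B * r ^ 2)
    (hf : Continuous f) {R K : ℝ} (hK : ∀ z, ‖f z‖ ≤ K) (h0 : 0 < α) {φ : ℕ → ℝ}
    {t : ℕ × ℕ × ℕ} (hs : 0 < scale α φ t.1) : Integrable (pairLinear α L R f φ t) := by
  have hb := integrableOn_const (μ := (volume : Measure ℂ)) (s := Metric.closedBall 0 1)
    (C := B * (R / α) ^ 2 * K) (measure_closedBall_lt_top.ne)
  have hA0 : 0 ≤ B * (R / α) ^ 2 * K :=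
    (norm_nonneg _).trans (norm_latticeSum_le hB hK h0 hs R 0)
  have hm := measurable_pairLinear (α := α) (L := L) (φ := φ) hf R t
  rw [← integrable_indicator_iff Metric.isClosed_closedBall.measurableSet] at hb
  refine hb.mono' hm.aestronglyMeasurable (Eventually.of_forall fun x => ?_)
  rw [pairLinear, norm_indicator_eq_indicator_norm]
  exact Set.indicator_le_indicator
    (norm_levelAverage_le hA0 fun k => norm_latticeSum_le hB hK h0 hs R _)

/-- On each circle, averaging over the levels equidistributes the argument of the derivative of the
level power, because `α - 1 ≠ 0`. -/
theorem norm_integral_pairLinear_sub_le {B : ℝ}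
    (hB : ∀ r, ((latticeBall L r).card : ℝ) ≤ B * r ^ 2)
    (hf : Continuous f) {R K : ℝ} (hK : ∀ z, ‖f z‖ ≤ K) (h0 : 0 < α) (h1 : α < 1) {φ : ℕ → ℝ}
    {t : ℕ × ℕ × ℕ} (hs : 0 < scale α φ t.1) (ht : 0 < t.2.1 + t.2.2) :
    ‖(∫ x, pairLinear α L R f φ t x)
      - ∫ r in Set.Ioc (0 : ℝ) 1, (r : ℂ) * radialSum L α R f (scale α φ t.1) (r ^ (α - 1))‖
      ≤ 4 * Real.pi * (B * (R / α) ^ 2 * K) / (|α - 1| * ((t.2.1 : ℝ) + t.2.2)) := by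
  obtain ⟨N, N', N''⟩ := t
  simp only at hs ht ⊢
  set s := scale α φ N with hsdef
  set A := B * (R / α) ^ 2 * K with hA
  have hA' : ∀ w, ‖latticeSum L α R f s w‖ ≤ A := fun w => norm_latticeSum_le hB hK h0 hs R w
  have hA0 : 0 ≤ A := (norm_nonneg _).trans (hA' 0)
  have hcont := continuous_latticeSum L α R hf s
  -- `G ρ` is the level average of the integrals over the circle of radius `ρ`
  set G : ℝ → ℂ := fun ρ => levelAverage N' N'' fun k =>
    ∫ θ in (0 : ℝ)..2 * Real.pi, latticeSum L α R f s
      (ρ * Complex.exp (((α - 1) * (θ + 2 * Real.pi * k) : ℝ) * Complex.I)) with hG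
  have hGc : Continuous G := by
    have : ∀ k : ℤ, Continuous fun ρ : ℝ => ∫ θ in (0 : ℝ)..2 * Real.pi, latticeSum L α R f s
        (ρ * Complex.exp (((α - 1) * (θ + 2 * Real.pi * k) : ℝ) * Complex.I)) := fun k =>
      intervalIntegral.continuous_parametric_intervalIntegral_of_continuous' (by fun_prop) _ _
    rw [hG]; unfold levelAverage; fun_prop
  have hkey : ∀ ρ : ℝ, 0 ≤ ρ → ‖G ρ - radialSum L α R f s ρ‖
      ≤ 4 * Real.pi * A / (|α - 1| * ((N' : ℝ) + N'')) := by
    intro ρ hρ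
    rw [← integral_latticeSum_circle hf R h0 hs hρ, hG]
    exact norm_levels_average_sub_le
      (h := fun θ : ℝ => latticeSum L α R f s (ρ * Complex.exp (θ * Complex.I)))
      (by fun_prop) (periodic_comp_circle _ _) (fun _ => hA' _) (by linarith) ht
  have hI : ∫ x, pairLinear α L R f φ (N, N', N'') x
      = ∫ r in Set.Ioc (0 : ℝ) 1, (r : ℂ) * G (r ^ (α - 1)) := by
    rw [integral_eq_integral_polar (measurable_pairLinear hf R _)
      (integrable_pairLinear hB hf hK h0 hs)]
    rw [setIntegral_eq_of_subset_of_forall_sdiff_eq_zero measurableSet_Ioi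
      (show Set.Ioc (0 : ℝ) 1 ⊆ Set.Ioi 0 from Set.Ioc_subset_Ioi_self)]
    · refine setIntegral_congr_fun measurableSet_Ioc fun r hr => ?_
      have hr0 : 0 < r := hr.1
      congr 1
      have hinn : ∀ᵐ θ : ℝ, θ ∈ Set.uIoc 0 (2 * Real.pi) →
          pairLinear α L R f φ (N, N', N'') (r * Complex.exp (θ * Complex.I))
          = levelAverage N' N'' fun k => latticeSum L α R f s ((r ^ (α - 1) : ℝ) *
            Complex.exp (((α - 1) * (θ + 2 * Real.pi * k) : ℝ) * Complex.I)) := by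
        have hne : ∀ᵐ θ : ℝ, θ ≠ 2 * Real.pi := by simp [ae_iff, measure_singleton]
        filter_upwards [hne] with θ hθ hmem
        rw [Set.uIoc_of_le Real.two_pi_pos.le] at hmem
        have hball : (r : ℂ) * Complex.exp (θ * Complex.I) ∈ Metric.closedBall (0 : ℂ) 1 := by
          rw [mem_closedBall_zero_iff, norm_mul, Complex.norm_exp_ofReal_mul_I, mul_one,
            Complex.norm_real, Real.norm_of_nonneg hr0.le]
          exact hr.2
        rw [pairLinear, Set.indicator_of_mem hball]
        simp only [levelPow_polar (α - 1) _ hr0 ⟨hmem.1.le, lt_of_le_of_ne hmem.2 hθ⟩]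
        rfl
      rw [intervalIntegral.integral_congr_ae hinn]
      simp only [levelAverage, hG]
      rw [intervalIntegral.integral_const_mul, intervalIntegral.integral_finsetSum
        (fun k _ => Continuous.intervalIntegrable (by fun_prop) _ _)]
    · intro r hr
      have hr1 : 1 < r := by
        by_contra h
        exact hr.2 ⟨hr.1, not_lt.1 h⟩
      have : ∀ θ : ℝ, pairLinear α L R f φ (N, N', N'') (r * Complex.exp (θ * Complex.I)) = 0 := by
        intro θ
        rw [pairLinear, Set.indicator_of_notMem]
        rw [mem_closedBall_zero_iff, norm_mul, Complex.norm_exp_ofReal_mul_I, mul_one,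
            Complex.norm_real, Real.norm_of_nonneg (by linarith)]
        exact not_le.2 hr1
      simp [this]
  have hrm : Measurable fun r : ℝ => r ^ (α - 1) := by fun_prop
  have hmG : Measurable fun r : ℝ => (r : ℂ) * G (r ^ (α - 1)) :=
    Complex.measurable_ofReal.mul (hGc.measurable.comp hrm)
  have hmS : Measurable fun r : ℝ => (r : ℂ) * radialSum L α R f s (r ^ (α - 1)) :=
    Complex.measurable_ofReal.mul ((continuous_radialSum hf R s).measurable.comp hrm)
  have hfin : volume (Set.Ioc (0 : ℝ) 1) ≠ ⊤ := by simp
  have hnorm : ∀ r ∈ Set.Ioc (0 : ℝ) 1, ∀ w : ℂ, ‖(r : ℂ) * w‖ ≤ ‖w‖ := by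
    intro r hr w
    rw [norm_mul, Complex.norm_real, Real.norm_of_nonneg hr.1.le]
    exact mul_le_of_le_one_left (norm_nonneg _) hr.2
  have hiS : IntegrableOn (fun r : ℝ => (r : ℂ) * radialSum L α R f s (r ^ (α - 1)))
      (Set.Ioc 0 1) := by
    refine Measure.integrableOn_of_bounded hfin hmS.aestronglyMeasurable
      (M := B * (R / α) ^ 2 * (2 * Real.pi * K)) ?_
    filter_upwards [ae_restrict_mem measurableSet_Ioc] with r hr
    exact (hnorm r hr _).trans (norm_radialSum_le hB hK h0 hs R _)
  have hiG : IntegrableOn (fun r : ℝ => (r : ℂ) * G (r ^ (α - 1))) (Set.Ioc 0 1) := by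
    refine Measure.integrableOn_of_bounded hfin hmG.aestronglyMeasurable
      (M := 4 * Real.pi * A / (|α - 1| * ((N' : ℝ) + N''))
        + B * (R / α) ^ 2 * (2 * Real.pi * K)) ?_
    filter_upwards [ae_restrict_mem measurableSet_Ioc] with r hr
    refine (hnorm r hr _).trans ?_
    have h3 := hkey (r ^ (α - 1)) (Real.rpow_nonneg hr.1.le _)
    have h4 := norm_radialSum_le hB hK h0 hs R (r ^ (α - 1))
    have h5 := norm_le_norm_sub_add (G (r ^ (α - 1))) (radialSum L α R f s (r ^ (α - 1)))
    linarith
  rw [hI, ← integral_sub hiG hiS]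
  have := norm_setIntegral_le_of_norm_le_const (μ := volume) (s := Set.Ioc (0 : ℝ) 1)
    (f := fun r : ℝ => (r : ℂ) * G (r ^ (α - 1))
      - (r : ℂ) * radialSum L α R f s (r ^ (α - 1)))
    (C := 4 * Real.pi * A / (|α - 1| * ((N' : ℝ) + N''))) (by simp) (fun r hr => by
      rw [← mul_sub]
      exact (hnorm r hr _).trans (hkey _ (Real.rpow_nonneg hr.1.le _)))
  simpa using this

end

/-- The pair correlation integrals are asymptotic to one-dimensional integrals not involving
the levels any more. -/
theorem tendsto_integral_levelPairCorrelation_sub {α : ℝ} (h0 : 0 < α) (h1 : α < 1)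
    {L : Submodule ℤ ℂ} [DiscreteTopology L] [IsZLattice ℝ L] {Λ : Set ℂ} (hΛ : IsGridOf L Λ)
    {f : ℂ → ℂ} (hf : Continuous f) (hfc : HasCompactSupport f) {R K : ℝ} (hR0 : 0 < R)
    (hR : ∀ z, R < ‖z‖ → f z = 0) (hK : ∀ z, ‖f z‖ ≤ K) {φ ψ : ℕ → ℝ}
    (hφ_pos : ∀ N : ℕ, 1 ≤ N → 0 < φ N) (hφ_top : Tendsto φ atTop atTop)
    (hψ : ∀ N : ℕ, 1 ≤ N → ψ N = ((N : ℝ) ^ (2 - α) / φ N) ^ 2) :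
    Tendsto (fun t : ℕ × ℕ × ℕ => ∫ z, f z ∂(levelPairCorrelation α Λ φ ψ t.1 t.2.1 t.2.2)
        - ((ZLattice.covolume L : ℝ) : ℂ)⁻¹ * ∫ r in Set.Ioc (0 : ℝ) 1,
          (r : ℂ) * radialSum L α R f (scale α φ t.1) (r ^ (α - 1)))
      (comap (fun t : ℕ × ℕ × ℕ => min t.1 (t.2.1 + t.2.2)) atTop) (𝓝 0) := by
  obtain ⟨z₀, hz₀⟩ := hΛ
  obtain ⟨B, hB0, hB⟩ := exists_card_latticeBall_le L
  have hT1 := tendsto_integral_pairStep_sub_pairLinear (L := L) (z₀ := z₀) h0 h1 hf hfc hR0 hR hK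
    hφ_pos hφ_top
  have hT2 : Tendsto (fun t : ℕ × ℕ × ℕ => (∫ x, pairLinear α L R f φ t x)
      - ∫ r in Set.Ioc (0 : ℝ) 1, (r : ℂ) * radialSum L α R f (scale α φ t.1) (r ^ (α - 1)))
      (comap (fun t : ℕ × ℕ × ℕ => min t.1 (t.2.1 + t.2.2)) atTop) (𝓝 0) := by
    have hlim : Tendsto (fun t : ℕ × ℕ × ℕ => 4 * Real.pi * (B * (R / α) ^ 2 * K)
        / (|α - 1| * ((t.2.1 : ℝ) + t.2.2)))
        (comap (fun t : ℕ × ℕ × ℕ => min t.1 (t.2.1 + t.2.2)) atTop) (𝓝 0) := by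
      have hM : Tendsto (fun t : ℕ × ℕ × ℕ => (t.2.1 : ℝ) + t.2.2)
          (comap (fun t : ℕ × ℕ × ℕ => min t.1 (t.2.1 + t.2.2)) atTop) atTop := by
        refine (tendsto_natCast_atTop_atTop.comp tendsto_levels_comap).congr fun t => ?_
        simp
      exact tendsto_const_nhds.div_atTop
        (hM.const_mul_atTop (abs_pos.2 (by linarith)))
    refine squeeze_zero_norm' ?_ hlim
    filter_upwards [tendsto_fst_comap.eventually (eventually_ge_atTop 1),
      tendsto_levels_comap.eventually (eventually_gt_atTop 0)] with t ht ht'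
    exact norm_integral_pairLinear_sub_le hB hf hK h0 h1 (scale_pos ht (hφ_pos _ ht)) ht'
  have hT := (hT1.add hT2).const_mul ((ZLattice.covolume L : ℝ) : ℂ)⁻¹
  rw [add_zero, mul_zero] at hT
  refine hT.congr' ?_
  filter_upwards [tendsto_fst_comap.eventually (eventually_ge_atTop 1)] with t ht
  rw [integral_eq_integral_pairStep hz₀ hφ_pos hψ ht]
  ring

/-! ### The limit of the radial integrals -/

section

variable {α : ℝ} {L : Submodule ℤ ℂ} [DiscreteTopology L] {f : ℂ → ℂ} {s : ℕ → ℝ}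

/-- For `ρ ≥ 1` the range of summation in `radialSum` can be enlarged, since the added terms are
outside the support. -/
theorem radialSum_eq_of_superset (hα : 0 < α) {R : ℝ} (hR : ∀ z, R < ‖z‖ → f z = 0) {σ r ρ : ℝ}
    (hσ : 0 < σ) (hρ : 1 ≤ ρ) (hr : R / (α * σ) ≤ r) :
    radialSum L α R f σ ρ
      = ((σ ^ 2 : ℝ) : ℂ) * ∑ p ∈ latticeBall L r, circleInt f (α * σ * ‖p‖ * ρ) := by
  rw [radialSum]
  congr 1
  refine Finset.sum_subset (latticeBall_mono L hr) fun p hp hp' => circleInt_eq_zero hR ?_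
  obtain ⟨hp0, hpL, -⟩ := mem_latticeBall.1 hp
  have h1 : R / (α * σ) < ‖p‖ := by
    by_contra h
    exact hp' (mem_latticeBall.2 ⟨hp0, hpL, not_lt.1 h⟩)
  rw [div_lt_iff₀ (by positivity)] at h1
  calc R < ‖p‖ * (α * σ) := h1
    _ ≤ ‖p‖ * (α * σ) * ρ := le_mul_of_one_le_right (by positivity) hρ
    _ = α * σ * ‖p‖ * ρ := by ring

theorem tendsto_radialSum_of_pos (hα : 0 < α) (hf : Continuous f) {R : ℝ}
    (hR : ∀ z, R < ‖z‖ → f z = 0) (hR0 : 0 < R) {σ : ℝ} (hσ : 0 < σ) (hs : Tendsto s atTop (𝓝 σ))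
    {ρ : ℝ} (hρ : 1 ≤ ρ) :
    Tendsto (fun N => radialSum L α R f (s N) ρ) atTop (𝓝 (radialSum L α R f σ ρ)) := by
  have hc := continuous_circleInt hf
  rw [radialSum_eq_of_superset (r := R / (α * (σ / 2))) hα hR hσ hρ (by gcongr; linarith)]
  have h2 : Tendsto (fun N => ((s N ^ 2 : ℝ) : ℂ) * ∑ p ∈ latticeBall L (R / (α * (σ / 2))),
      circleInt f (α * s N * ‖p‖ * ρ)) atTop (𝓝 (((σ ^ 2 : ℝ) : ℂ) *
        ∑ p ∈ latticeBall L (R / (α * (σ / 2))), circleInt f (α * σ * ‖p‖ * ρ))) := by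
    have hcont : Continuous fun x : ℝ => ((x ^ 2 : ℝ) : ℂ) *
      ∑ p ∈ latticeBall L (R / (α * (σ / 2))), circleInt f (α * x * ‖p‖ * ρ) := by fun_prop
    exact (hcont.tendsto σ).comp hs
  refine h2.congr' ?_
  filter_upwards [hs.eventually (lt_mem_nhds (half_lt_self hσ))] with N hN
  have hN0 : 0 < s N := (half_pos hσ).trans hN
  exact (radialSum_eq_of_superset hα hR hN0 hρ (by gcongr)).symm

theorem eventually_radialSum_eq_zero (hα : 0 < α) {R : ℝ} (hs : Tendsto s atTop atTop) :
    ∀ᶠ N in atTop, ∀ ρ, radialSum L α R f (s N) ρ = 0 := by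
  obtain ⟨δ, hδ, hempty⟩ := exists_latticeBall_eq_empty L
  have h : Tendsto (fun N => R / (α * s N)) atTop (𝓝 0) :=
    tendsto_const_nhds.div_atTop (hs.const_mul_atTop hα)
  filter_upwards [h.eventually_lt_const hδ] with N hN ρ
  rw [radialSum, hempty _ hN]
  simp

/-- As the scale tends to `0`, the lattice sums are Riemann sums of an integral over the plane. -/
theorem tendsto_radialSum_of_tendsto_zero [IsZLattice ℝ L] (hα : 0 < α) (hf : Continuous f)
    {R K : ℝ} (hR : ∀ z, R < ‖z‖ → f z = 0) (hK : ∀ z, ‖f z‖ ≤ K)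
    (hs0 : ∀ᶠ N in atTop, 0 < s N) (hs : Tendsto s atTop (𝓝 0)) {ρ : ℝ} (hρ : 1 ≤ ρ) :
    Tendsto (fun N => radialSum L α R f (s N) ρ) atTop
      (𝓝 (((ZLattice.covolume L : ℝ) : ℂ)⁻¹ * ∫ y : ℂ, circleInt f (α * ρ * ‖y‖))) := by
  obtain ⟨C, hC, hdist⟩ := exists_norm_gridPoint_sub_le L
  have hcov : 0 < ZLattice.covolume L := ZLattice.covolume_pos L _
  have hc := continuous_circleInt hf
  have hρ0 : 0 < ρ := one_pos.trans_le hρ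
  -- the step function whose integral is `covolume L` times the sum, with the term `p = 0` included
  set g : ℕ → ℂ → ℂ := fun N y =>
    circleInt f (α * ρ * (s N * ‖gridPoint L 0 (((s N)⁻¹ : ℝ) * y)‖)) with hg
  have hcell : ∀ N, 0 < s N → g N = fun y : ℂ =>
      cellFun L 0 (insert 0 (latticeBall L (R / (α * s N))))
        (fun p => circleInt f (α * s N * ‖p‖ * ρ)) (((s N)⁻¹ : ℝ) • y) := by
    intro N hN
    ext y
    simp only [hg, cellFun, Complex.real_smul]
    set p := gridPoint L 0 (((s N)⁻¹ : ℝ) * y)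
    have harg : α * ρ * (s N * ‖p‖) = α * s N * ‖p‖ * ρ := by ring
    rw [harg]
    split_ifs with hmem
    · rfl
    · refine circleInt_eq_zero hR ?_
      rw [Finset.mem_insert, not_or] at hmem
      have h1 : R / (α * s N) < ‖p‖ := by
        by_contra h
        refine hmem.2 (mem_latticeBall.2 ⟨hmem.1, ?_, not_lt.1 h⟩)
        have := gridPoint_sub_mem L 0 (((s N)⁻¹ : ℝ) * y)
        rwa [sub_zero] at this
      rw [div_lt_iff₀ (by positivity)] at h1
      calc R < ‖p‖ * (α * s N) := h1
        _ ≤ ‖p‖ * (α * s N) * ρ := le_mul_of_one_le_right (by positivity) hρ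
        _ = α * s N * ‖p‖ * ρ := by ring
  have hS : ∀ N, ∀ n ∈ insert 0 (latticeBall L (R / (α * s N))), n - 0 ∈ L := by
    intro N n hn
    rw [sub_zero]
    rcases Finset.mem_insert.1 hn with rfl | h
    · exact L.zero_mem
    · exact (mem_latticeBall.1 h).2.1
  have hint : ∀ N, 0 < s N → ((ZLattice.covolume L : ℝ) : ℂ)⁻¹ * ∫ y, g N y
      = ((s N ^ 2 : ℝ) : ℂ) * circleInt f 0 + radialSum L α R f (s N) ρ := by
    intro N hN
    rw [hcell N hN, Measure.integral_comp_smul, integral_cellFun L (hS N),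
      Finset.sum_insert (by simp [mem_latticeBall]), Complex.finrank_real_complex, radialSum,
      Complex.real_smul, inv_pow, inv_inv, abs_of_pos (by positivity)]
    have : ((ZLattice.covolume L : ℝ) : ℂ) ≠ 0 := by exact_mod_cast hcov.ne'
    simp only [norm_zero, mul_zero, zero_mul]
    rw [mul_left_comm, inv_mul_cancel_left₀ this, mul_add]
  have hlim : Tendsto (fun N => ∫ y, g N y) atTop (𝓝 (∫ y : ℂ, circleInt f (α * ρ * ‖y‖))) := by
    refine tendsto_integral_filter_of_dominated_convergence
      (Set.indicator (Metric.closedBall 0 (R / α + C)) fun _ => 2 * Real.pi * K) ?_ ?_ ?_ ?_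
    · filter_upwards [hs0] with N hN
      rw [hcell N hN]
      exact ((measurable_cellFun L (hS N) _).comp (measurable_const_smul _)).aestronglyMeasurable
    · filter_upwards [hs0, hs.eventually (gt_mem_nhds one_pos)] with N hN hN1
      refine Eventually.of_forall fun y => ?_
      by_cases hy : y ∈ Metric.closedBall (0 : ℂ) (R / α + C)
      · rw [Set.indicator_of_mem hy]; exact norm_circleInt_le hK _
      · rw [Set.indicator_of_notMem hy, hg]
        simp only
        rw [circleInt_eq_zero hR, norm_zero]
        rw [mem_closedBall_zero_iff, not_le] at hy
        have h1 := hdist 0 (((s N)⁻¹ : ℝ) * y)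
        have h2 := norm_sub_norm_le ((((s N)⁻¹ : ℝ) : ℂ) * y) (gridPoint L 0 (((s N)⁻¹ : ℝ) * y))
        rw [norm_sub_rev, norm_mul, Complex.norm_real, Real.norm_of_nonneg (by positivity)] at h2
        set p := gridPoint L 0 (((s N)⁻¹ : ℝ) * y)
        have h3 : ‖y‖ - s N * ‖p‖ ≤ s N * C := by
          have := mul_le_mul_of_nonneg_left (h2.trans h1) hN.le
          rwa [mul_sub, mul_inv_cancel_left₀ hN.ne'] at this
        have h4 : s N * C ≤ C := mul_le_of_le_one_left hC.le hN1.le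
        have h5 : R / α < s N * ‖p‖ := by linarith
        rw [div_lt_iff₀ hα] at h5
        calc R < s N * ‖p‖ * α := h5
          _ ≤ s N * ‖p‖ * α * ρ := le_mul_of_one_le_right (by positivity) hρ
          _ = α * ρ * (s N * ‖p‖) := by ring
    · rw [integrable_indicator_iff Metric.isClosed_closedBall.measurableSet]
      exact integrableOn_const (measure_closedBall_lt_top.ne)
    · refine Eventually.of_forall fun y => ?_
      refine (hc.tendsto _).comp (Tendsto.const_mul _ ?_)
      rw [tendsto_iff_norm_sub_tendsto_zero]
      have hsC : Tendsto (fun N => s N * C) atTop (𝓝 0) := by simpa using hs.mul_const C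
      refine squeeze_zero' (Eventually.of_forall fun _ => norm_nonneg _) ?_ hsC
      filter_upwards [hs0] with N hN
      have h1 := hdist 0 (((s N)⁻¹ : ℝ) * y)
      set p := gridPoint L 0 (((s N)⁻¹ : ℝ) * y)
      have h2 := (abs_norm_sub_norm_le p ((((s N)⁻¹ : ℝ) : ℂ) * y)).trans h1
      rw [norm_mul, Complex.norm_real, Real.norm_of_nonneg (by positivity)] at h2
      rw [Real.norm_eq_abs]
      have h3 : s N * ‖p‖ - ‖y‖ = s N * (‖p‖ - (s N)⁻¹ * ‖y‖) := by
        rw [mul_sub, mul_inv_cancel_left₀ hN.ne']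
      rw [h3, abs_mul, abs_of_pos hN]
      gcongr
  have h0 : Tendsto (fun N => ((s N ^ 2 : ℝ) : ℂ) * circleInt f 0) atTop (𝓝 0) := by
    have hcc : Continuous fun x : ℝ => ((x ^ 2 : ℝ) : ℂ) * circleInt f 0 := by fun_prop
    simpa [Function.comp_def] using (hcc.tendsto 0).comp hs
  have := (hlim.const_mul ((ZLattice.covolume L : ℝ) : ℂ)⁻¹).sub h0
  rw [sub_zero] at this
  refine this.congr' ?_
  filter_upwards [hs0] with N hN
  rw [hint N hN]; ring

theorem tendsto_radial_integral [IsZLattice ℝ L] (hα : 0 < α) (hα1 : α < 1) (hf : Continuous f)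
    {R K : ℝ} (hK : ∀ z, ‖f z‖ ≤ K)
    (hs0 : ∀ᶠ N in atTop, 0 < s N) {G : ℝ → ℂ}
    (hG : ∀ ρ, 1 ≤ ρ → Tendsto (fun N => radialSum L α R f (s N) ρ) atTop (𝓝 (G ρ))) :
    Tendsto (fun N => ∫ r in Set.Ioc (0 : ℝ) 1,
        (r : ℂ) * radialSum L α R f (s N) (r ^ (α - 1))) atTop
      (𝓝 (∫ r in Set.Ioc (0 : ℝ) 1, (r : ℂ) * G (r ^ (α - 1)))) := by
  obtain ⟨B, hB0, hB⟩ := exists_card_latticeBall_le L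
  have hrm : Measurable fun r : ℝ => r ^ (α - 1) := by fun_prop
  refine tendsto_integral_filter_of_dominated_convergence
    (fun _ => B * (R / α) ^ 2 * (2 * Real.pi * K)) ?_ ?_ ?_ ?_
  · exact Eventually.of_forall fun N => (Complex.measurable_ofReal.mul
      ((continuous_radialSum hf R _).measurable.comp hrm)).aestronglyMeasurable
  · filter_upwards [hs0] with N hN
    filter_upwards [ae_restrict_mem measurableSet_Ioc] with r hr
    rw [norm_mul, Complex.norm_real, Real.norm_of_nonneg hr.1.le]
    exact (mul_le_of_le_one_left (norm_nonneg _) hr.2).trans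
      (norm_radialSum_le hB hK hα hN R _)
  · exact integrableOn_const (by simp)
  · filter_upwards [ae_restrict_mem measurableSet_Ioc] with r hr
    exact (hG _ (Real.one_le_rpow_of_pos_of_le_one_of_nonpos hr.1 hr.2 (by linarith))).const_mul _

end

/-! ### Identification of the limit density -/

theorem integral_circleInt_norm {f : ℂ → ℂ} (hf : Continuous f) (hfc : HasCompactSupport f) {R : ℝ}
    (hR : ∀ z, R < ‖z‖ → f z = 0) :
    ∫ y : ℂ, circleInt f ‖y‖ = 2 * Real.pi * ∫ z, f z := by
  have hc := continuous_circleInt hf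
  have hi : Integrable fun y : ℂ => circleInt f ‖y‖ := by
    refine Continuous.integrable_of_hasCompactSupport (by fun_prop) ?_
    refine HasCompactSupport.intro (isCompact_closedBall 0 R) fun y hy => circleInt_eq_zero hR ?_
    rwa [mem_closedBall_zero_iff, not_le] at hy
  rw [integral_eq_integral_polar hf.measurable (hf.integrable_of_hasCompactSupport hfc),
    integral_eq_integral_polar (by fun_prop) hi, ← integral_const_mul]
  refine setIntegral_congr_fun measurableSet_Ioi fun r hr => ?_
  have hr : 0 < r := hr
  simp only [norm_mul, Complex.norm_exp_ofReal_mul_I, mul_one, Complex.norm_real,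
    Real.norm_of_nonneg hr.le]
  rw [intervalIntegral.integral_const, sub_zero, Complex.real_smul, circleInt]
  push_cast; ring

/-- The radial integral for `λ = 0`. -/
theorem integral_radial_of_zero {α : ℝ} (h0 : 0 < α) (h1 : α < 1) {f : ℂ → ℂ} (hf : Continuous f)
    (hfc : HasCompactSupport f) {R : ℝ} (hR : ∀ z, R < ‖z‖ → f z = 0) :
    ∫ r in Set.Ioc (0 : ℝ) 1, (r : ℂ) * ∫ y : ℂ, circleInt f (α * r ^ (α - 1) * ‖y‖)
      = ((Real.pi / (α ^ 2 * (2 - α)) : ℝ) : ℂ) * ∫ z, f z := by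
  have hpt : ∀ r ∈ Set.Ioc (0 : ℝ) 1, (r : ℂ) * ∫ y : ℂ, circleInt f (α * r ^ (α - 1) * ‖y‖)
      = ((r ^ (3 - 2 * α) : ℝ) : ℂ) * (((2 * Real.pi / α ^ 2 : ℝ) : ℂ) * ∫ z, f z) := by
    intro r hr
    have hr0 : 0 < r := hr.1
    have hρ : 0 < α * r ^ (α - 1) := by positivity
    have := Measure.integral_comp_smul (volume : Measure ℂ) (fun y => circleInt f ‖y‖)
      (α * r ^ (α - 1))
    simp only [norm_smul, Real.norm_of_nonneg hρ.le] at this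
    rw [this, integral_circleInt_norm hf hfc hR, Complex.finrank_real_complex,
      abs_of_pos (by positivity), Complex.real_smul]
    have e : r * ((α * r ^ (α - 1)) ^ 2)⁻¹ = r ^ (3 - 2 * α) * (1 / α ^ 2) := by
      have e1 : r ^ (3 - 2 * α) * (r ^ (α - 1)) ^ 2 = r := by
        rw [← Real.rpow_natCast, ← Real.rpow_mul hr0.le, ← Real.rpow_add hr0]
        convert Real.rpow_one r using 2; push_cast; ring
      calc r * ((α * r ^ (α - 1)) ^ 2)⁻¹
          = r ^ (3 - 2 * α) * (r ^ (α - 1)) ^ 2 * ((α * r ^ (α - 1)) ^ 2)⁻¹ := by rw [e1]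
        _ = _ := by
          have : 0 < r ^ (α - 1) := by positivity
          field_simp
    rw [← mul_assoc, ← Complex.ofReal_mul, e]
    push_cast; ring
  rw [setIntegral_congr_fun measurableSet_Ioc hpt, integral_mul_const, integral_complex_ofReal,
    ← intervalIntegral.integral_of_le zero_le_one, integral_rpow (Or.inl (by linarith)), ← mul_assoc,
    ← Complex.ofReal_mul]
  congr 2
  rw [Real.one_rpow, Real.zero_rpow (by linarith)]
  have : 3 - 2 * α + 1 ≠ 0 := by linarith
  have : 2 - α ≠ 0 := by linarith
  field_simp; ring

/-- The substitution `t = a r ^ (α - 1)`. -/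
theorem integral_Ioc_comp_rpow {α a : ℝ} (h1 : α < 1) (ha : 0 < a) (F : ℝ → ℂ) :
    ∫ r in Set.Ioc (0 : ℝ) 1, (r : ℂ) * F (a * r ^ (α - 1))
      = ∫ t in Set.Ioi (0 : ℝ), Set.indicator (Set.Ici a) (fun t =>
        ((a ^ (2 / (1 - α)) / (1 - α) * t ^ (-(2 / (1 - α)) - 1) : ℝ) : ℂ) * F t) t := by
  set g : ℝ → ℂ := Set.indicator (Set.Ici a) (fun t =>
        ((a ^ (2 / (1 - α)) / (1 - α) * t ^ (-(2 / (1 - α)) - 1) : ℝ) : ℂ) * F t) with hg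
  have e1 := integral_comp_mul_left_Ioi g 0 ha
  rw [mul_zero] at e1
  have e2 := integral_comp_rpow_Ioi (fun x => g (a * x)) (p := α - 1) (by linarith)
  rw [e1, eq_inv_smul_iff₀ ha.ne', ← integral_smul] at e2
  rw [← e2, setIntegral_eq_of_subset_of_forall_sdiff_eq_zero measurableSet_Ioi
      (show Set.Ioc (0 : ℝ) 1 ⊆ Set.Ioi 0 from Set.Ioc_subset_Ioi_self)]
  · refine setIntegral_congr_fun measurableSet_Ioc fun r hr => ?_
    have hr0 : 0 < r := hr.1
    have hmem : a * r ^ (α - 1) ∈ Set.Ici a := by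
      refine le_mul_of_one_le_right ha.le ?_
      exact Real.one_le_rpow_of_pos_of_le_one_of_nonpos hr.1 hr.2 (by linarith)
    simp only [hg]
    rw [Set.indicator_of_mem hmem, Complex.real_smul, Complex.real_smul, ← mul_assoc, ← mul_assoc,
      ← Complex.ofReal_mul, ← Complex.ofReal_mul]
    congr 2
    have h1' : 0 < 1 - α := by linarith
    rw [abs_of_neg (by linarith), Real.mul_rpow ha.le (by positivity), ← Real.rpow_mul hr0.le,
      Real.rpow_sub ha, Real.rpow_neg ha.le, Real.rpow_one]
    have e3 : r ^ (α - 1 - 1) * r ^ ((α - 1) * (-(2 / (1 - α)) - 1)) = r := by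
      rw [← Real.rpow_add hr0]
      convert Real.rpow_one r using 2
      field_simp; ring
    have : 0 < a ^ (2 / (1 - α)) := by positivity
    calc r = r ^ (α - 1 - 1) * r ^ ((α - 1) * (-(2 / (1 - α)) - 1)) := e3.symm
      _ = _ := by field_simp; ring
  · intro r hr
    have hr0 : 0 < r := hr.1
    have hr1 : 1 < r := by
      by_contra h
      exact hr.2 ⟨hr.1, not_lt.1 h⟩
    have hnm : a * r ^ (α - 1) ∉ Set.Ici a := by
      rw [Set.mem_Ici, not_le]
      exact mul_lt_of_lt_one_right ha (Real.rpow_lt_one_of_one_lt_of_neg hr1 (by linarith))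
    simp [hg, Set.indicator_of_notMem hnm]

/-- The part of the limit density due to the displacement `p`, as a function of the modulus. -/
noncomputable def densityTerm (α : ℝ) (L : Submodule ℤ ℂ) (σ : ℝ) (p : ℂ) : ℝ → ℝ :=
  Set.indicator (Set.Ici (α * σ * ‖p‖)) fun t =>
    α ^ (2 / (1 - α)) / ((1 - α) * ZLattice.covolume L) *
      (t / σ) ^ (-((4 - 2 * α) / (1 - α))) * ‖p‖ ^ (2 / (1 - α))

theorem measurable_densityTerm (α : ℝ) (L : Submodule ℤ ℂ) (σ : ℝ) (p : ℂ) :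
    Measurable (densityTerm α L σ p) := by
  unfold densityTerm
  refine Measurable.indicator ?_ measurableSet_Ici
  fun_prop

section

variable {α : ℝ} {L : Submodule ℤ ℂ} [DiscreteTopology L]

theorem limitDensity_eq_sum (h0 : 0 < α) (h1 : α < 1) {lam : ℝ≥0∞} (hl0 : lam ≠ 0)
    (hl : lam ≠ ⊤) {r : ℝ} {z : ℂ} (hz : ‖z‖ ≤ r) :
    limitDensity α L lam z
      = ∑ p ∈ latticeBall L (r / (α * lam.toReal)), densityTerm α L lam.toReal p ‖z‖ := by
  have hσ : 0 < lam.toReal := ENNReal.toReal_pos hl0 hl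
  set σ := lam.toReal
  have hq : 2 / (1 - α) ≠ 0 := by
    have : 0 < 1 - α := by linarith
    positivity
  have hsum : ∑ᶠ p ∈ {p : ℂ | p ∈ L ∧ ‖p‖ ≤ ‖z‖ / (α * σ)}, ‖p‖ ^ (2 / (1 - α))
      = ∑ p ∈ latticeBall L (‖z‖ / (α * σ)), ‖p‖ ^ (2 / (1 - α)) := by
    rw [finsum_mem_eq_finite_toFinset_sum _ (finite_lattice_inter_ball L _), latticeBall]
    symm
    refine Finset.sum_subset (Finset.erase_subset _ _) fun p hp hp' => ?_
    have hp0 : p = 0 := by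
      by_contra h
      exact hp' (Finset.mem_erase.2 ⟨h, hp⟩)
    rw [hp0, norm_zero, Real.zero_rpow hq]
  rw [limitDensity, if_neg hl, if_neg hl0, hsum, Finset.mul_sum]
  refine (Finset.sum_congr rfl fun p hp => ?_).trans
    (Finset.sum_subset (latticeBall_mono L (by gcongr)) fun p hp hp' => ?_)
  · have hpn := (mem_latticeBall.1 hp).2.2
    rw [le_div_iff₀ (by positivity)] at hpn
    rw [densityTerm, Set.indicator_of_mem (Set.mem_Ici.2 (by linarith))]
  · rw [densityTerm, Set.indicator_of_notMem]
    rw [Set.mem_Ici, not_le]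
    obtain ⟨hp0, hpL, -⟩ := mem_latticeBall.1 hp
    by_contra h
    refine hp' (mem_latticeBall.2 ⟨hp0, hpL, ?_⟩)
    rw [le_div_iff₀ (by positivity)]
    linarith

variable [IsZLattice ℝ L]

theorem densityTerm_nonneg (h0 : 0 < α) (h1 : α < 1) {σ : ℝ} (hσ : 0 < σ) (p : ℂ) (t : ℝ) :
    0 ≤ densityTerm α L σ p t := by
  have hcov : 0 < ZLattice.covolume L := ZLattice.covolume_pos L _
  have : 0 < 1 - α := by linarith
  refine Set.indicator_nonneg (fun t ht => ?_) t
  have : 0 ≤ t := le_trans (by positivity) (Set.mem_Ici.1 ht)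
  positivity

theorem densityTerm_le (h0 : 0 < α) (h1 : α < 1) {σ : ℝ} (hσ : 0 < σ) {p : ℂ} (hp : p ≠ 0) (t : ℝ) :
    densityTerm α L σ p t ≤ α ^ (2 / (1 - α)) / ((1 - α) * ZLattice.covolume L) *
      (α * ‖p‖) ^ (-((4 - 2 * α) / (1 - α))) * ‖p‖ ^ (2 / (1 - α)) := by
  have hcov : 0 < ZLattice.covolume L := ZLattice.covolume_pos L _
  have h1' : 0 < 1 - α := by linarith
  have hp0 := norm_pos_iff.2 hp
  rw [densityTerm, Set.indicator_apply]
  split_ifs with ht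
  · have h2 : α * ‖p‖ ≤ t / σ := by
      rw [le_div_iff₀ hσ]; rw [Set.mem_Ici] at ht; linarith
    have h3 : 0 ≤ (4 - 2 * α) / (1 - α) := div_nonneg (by linarith) h1'.le
    have h4 := Real.rpow_le_rpow_of_nonpos (by positivity) h2 (neg_nonpos.2 h3)
    gcongr
  · positivity

theorem limitDensity_nonneg (h0 : 0 < α) (h1 : α < 1) (lam : ℝ≥0∞) (z : ℂ) :
    0 ≤ limitDensity α L lam z := by
  have hcov : 0 < ZLattice.covolume L := ZLattice.covolume_pos L _
  by_cases hl : lam = ⊤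
  · simp [limitDensity, hl]
  by_cases hl0 : lam = 0
  · have : 0 < 2 - α := by linarith
    rw [limitDensity, if_neg hl, if_pos hl0]; positivity
  · rw [limitDensity_eq_sum h0 h1 hl0 hl le_rfl]
    exact Finset.sum_nonneg fun p _ =>
      densityTerm_nonneg h0 h1 (ENNReal.toReal_pos hl0 hl) p _

theorem exists_limitDensity_le (h0 : 0 < α) (h1 : α < 1) (lam : ℝ≥0∞) (r : ℝ) :
    ∃ M : ℝ, ∀ z, ‖z‖ ≤ r → limitDensity α L lam z ≤ M := by
  by_cases hl : lam = ⊤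
  · exact ⟨0, fun z _ => by simp [limitDensity, hl]⟩
  by_cases hl0 : lam = 0
  · exact ⟨Real.pi / (α ^ 2 * (2 - α) * ZLattice.covolume L ^ 2),
      fun z _ => by rw [limitDensity, if_neg hl, if_pos hl0]⟩
  · refine ⟨∑ p ∈ latticeBall L (r / (α * lam.toReal)),
      α ^ (2 / (1 - α)) / ((1 - α) * ZLattice.covolume L) *
        (α * ‖p‖) ^ (-((4 - 2 * α) / (1 - α))) * ‖p‖ ^ (2 / (1 - α)), fun z hz => ?_⟩
    rw [limitDensity_eq_sum h0 h1 hl0 hl hz]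
    exact Finset.sum_le_sum fun p hp =>
      densityTerm_le h0 h1 (ENNReal.toReal_pos hl0 hl) (mem_latticeBall.1 hp).1 _

theorem isLocallyFiniteMeasure_limitDensity (h0 : 0 < α) (h1 : α < 1) (lam : ℝ≥0∞) :
    IsLocallyFiniteMeasure
      (volume.withDensity fun z : ℂ => ENNReal.ofReal (limitDensity α L lam z)) := by
  refine ⟨fun x => ⟨Metric.closedBall 0 (‖x‖ + 1), ?_, ?_⟩⟩
  · refine mem_of_superset (Metric.closedBall_mem_nhds x one_pos) fun y hy => ?_
    rw [mem_closedBall_zero_iff]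
    rw [mem_closedBall_iff_norm] at hy
    have := norm_sub_norm_le y x
    linarith
  · obtain ⟨M, hM⟩ := exists_limitDensity_le (L := L) h0 h1 lam (‖x‖ + 1)
    rw [withDensity_apply _ Metric.isClosed_closedBall.measurableSet]
    refine lt_of_le_of_lt (setLIntegral_mono measurable_const (g := fun _ => ENNReal.ofReal M)
      fun z hz => ENNReal.ofReal_le_ofReal (hM z (mem_closedBall_zero_iff.1 hz))) ?_
    rw [setLIntegral_const]
    exact ENNReal.mul_lt_top ENNReal.ofReal_lt_top measure_closedBall_lt_top

theorem integral_withDensity_limitDensity (h0 : 0 < α) (h1 : α < 1) (lam : ℝ≥0∞) (f : ℂ → ℂ) :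
    ∫ z, f z ∂(volume.withDensity fun z : ℂ => ENNReal.ofReal (limitDensity α L lam z))
      = ∫ z, (limitDensity α L lam z : ℂ) * f z := by
  rw [integral_withDensity_eq_integral_toReal_smul
    (measurable_limitDensity α h0 L lam).ennreal_ofReal
    (Eventually.of_forall fun _ => ENNReal.ofReal_lt_top)]
  refine integral_congr_ae (Eventually.of_forall fun z => ?_)
  simp only [ENNReal.toReal_ofReal (limitDensity_nonneg h0 h1 lam z), Complex.real_smul]

/-- In polar coordinates, each part of the limit density is, up to a constant, the image of the measure `r dr` on `(0, 1]`
under `r ↦ α σ ‖p‖ r ^ (α - 1)`, as described by `integral_Ioc_comp_rpow`. -/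
theorem mul_densityTerm (h0 : 0 < α) (h1 : α < 1) {σ : ℝ} (hσ : 0 < σ) (p : ℂ)
    (F : ℝ → ℂ) {t : ℝ} (ht : 0 < t) :
    ((t * densityTerm α L σ p t : ℝ) : ℂ) * F t
      = ((σ ^ 2 / ZLattice.covolume L : ℝ) : ℂ) * Set.indicator (Set.Ici (α * σ * ‖p‖)) (fun t =>
        (((α * σ * ‖p‖) ^ (2 / (1 - α)) / (1 - α) * t ^ (-(2 / (1 - α)) - 1) : ℝ) : ℂ) * F t) t := by
  have h1' : 0 < 1 - α := by linarith
  have hcov : 0 < ZLattice.covolume L := ZLattice.covolume_pos L _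
  by_cases hmem : t ∈ Set.Ici (α * σ * ‖p‖)
  · rw [densityTerm, Set.indicator_of_mem hmem, Set.indicator_of_mem hmem, ← mul_assoc (G := ℂ),
      ← Complex.ofReal_mul]
    congr 2
    have e : -((4 - 2 * α) / (1 - α)) = -(2 / (1 - α)) - 1 - 1 := by field_simp; ring
    have hq : 0 < σ ^ (2 / (1 - α)) := by positivity
    rw [e, Real.rpow_sub (by positivity) _ 1, Real.rpow_sub (by positivity) _ 1,
      Real.rpow_sub ht _ 1, Real.rpow_neg (by positivity), Real.rpow_neg ht.le,
      Real.div_rpow ht.le hσ.le, Real.mul_rpow (by positivity) (norm_nonneg _),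
      Real.mul_rpow h0.le hσ.le, Real.rpow_one, Real.rpow_one]
    have hq2 : 0 < t ^ (2 / (1 - α)) := by positivity
    field_simp
  · rw [densityTerm, Set.indicator_of_notMem hmem, Set.indicator_of_notMem hmem]
    simp

/-- The radial integral for `0 < λ < ∞`. -/
theorem integral_radial_of_pos (h0 : 0 < α) (h1 : α < 1) {f : ℂ → ℂ} (hf : Continuous f)
    (hfc : HasCompactSupport f) {R K : ℝ} (hR : ∀ z, R < ‖z‖ → f z = 0) (hK : ∀ z, ‖f z‖ ≤ K)
    {lam : ℝ≥0∞} (hl0 : lam ≠ 0) (hl : lam ≠ ⊤) :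
    ((ZLattice.covolume L : ℝ) : ℂ)⁻¹ * ∫ r in Set.Ioc (0 : ℝ) 1,
        (r : ℂ) * radialSum L α R f lam.toReal (r ^ (α - 1))
      = ∫ z, (limitDensity α L lam z : ℂ) * f z := by
  have h1' : 0 < 1 - α := by linarith
  have hσ : 0 < lam.toReal := ENNReal.toReal_pos hl0 hl
  have hcont := continuous_circleInt hf
  set σ := lam.toReal with hσdef
  set Q := latticeBall L (R / (α * σ)) with hQ
  set g : ℝ → ℝ := fun t => ∑ p ∈ Q, densityTerm α L σ p t with hg
  have hgm : Measurable g := Finset.measurable_fun_sum _ fun p _ => measurable_densityTerm α L σ p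
  have hK0 : 0 ≤ K := (norm_nonneg _).trans (hK 0)
  have hpos : ∀ p ∈ Q, 0 < α * σ * ‖p‖ := fun p hp => by
    have := norm_pos_iff.2 (mem_latticeBall.1 hp).1
    positivity
  have e1 : ∫ z, (limitDensity α L lam z : ℂ) * f z = ∫ z : ℂ, (g ‖z‖ : ℂ) * f z := by
    refine integral_congr_ae (Eventually.of_forall fun z => ?_)
    simp only
    rcases le_or_gt ‖z‖ R with hz | hz
    · rw [limitDensity_eq_sum h0 h1 hl0 hl hz]
    · rw [hR z hz, mul_zero, mul_zero]
  have hint : Integrable fun z : ℂ => (g ‖z‖ : ℂ) * f z := by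
    refine (hf.integrable_of_hasCompactSupport hfc).bdd_mul
      (c := ∑ p ∈ Q, α ^ (2 / (1 - α)) / ((1 - α) * ZLattice.covolume L) *
        (α * ‖p‖) ^ (-((4 - 2 * α) / (1 - α))) * ‖p‖ ^ (2 / (1 - α)))
      (Complex.measurable_ofReal.comp (hgm.comp measurable_norm)).aestronglyMeasurable
      (Eventually.of_forall fun z => ?_)
    rw [Complex.norm_real, Real.norm_of_nonneg
      (Finset.sum_nonneg fun p _ => densityTerm_nonneg h0 h1 hσ p _)]
    exact Finset.sum_le_sum fun p hp => densityTerm_le h0 h1 hσ (mem_latticeBall.1 hp).1 _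
  set T : ℂ → ℝ → ℂ := fun p => Set.indicator (Set.Ici (α * σ * ‖p‖)) (fun t =>
    (((α * σ * ‖p‖) ^ (2 / (1 - α)) / (1 - α) * t ^ (-(2 / (1 - α)) - 1) : ℝ) : ℂ)
      * circleInt f t) with hT
  have hTint : ∀ p ∈ Q, IntegrableOn (T p) (Set.Ioi 0) := by
    intro p hp
    set a := α * σ * ‖p‖ with ha
    have ha0 : 0 < a := hpos p hp
    have hb : Integrable (Set.indicator (Set.Icc a R) fun _ : ℝ =>
        a ^ (2 / (1 - α)) / (1 - α) * a ^ (-(2 / (1 - α)) - 1) * (2 * Real.pi * K)) := by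
      rw [integrable_indicator_iff measurableSet_Icc]
      exact integrableOn_const (by simp)
    refine (hb.mono' ?_ (Eventually.of_forall fun t => ?_)).integrableOn
    · refine (Measurable.indicator ?_ measurableSet_Ici).aestronglyMeasurable
      have := hcont.measurable
      fun_prop
    · simp only [hT]
      by_cases hta : t ∈ Set.Ici a
      · rcases le_or_gt t R with htR | htR
        · have ht0 : 0 < t := ha0.trans_le hta
          rw [Set.indicator_of_mem hta, Set.indicator_of_mem (Set.mem_Icc.2 ⟨hta, htR⟩), norm_mul,
            Complex.norm_real, Real.norm_of_nonneg (by positivity)]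
          have h2 := Real.rpow_le_rpow_of_nonpos ha0 (Set.mem_Ici.1 hta)
            (show -(2 / (1 - α)) - 1 ≤ 0 by
              have : 0 < 2 / (1 - α) := by positivity
              linarith)
          have h3 := norm_circleInt_le hK t
          gcongr
        · rw [Set.indicator_of_mem hta, circleInt_eq_zero hR htR, mul_zero, norm_zero]
          exact Set.indicator_nonneg (fun _ _ => by positivity) _
      · rw [Set.indicator_of_notMem hta, norm_zero]
        exact Set.indicator_nonneg (fun _ _ => by positivity) _
  have e2 : ∫ z : ℂ, (g ‖z‖ : ℂ) * f z
      = ((σ ^ 2 / ZLattice.covolume L : ℝ) : ℂ) * ∑ p ∈ Q, ∫ t in Set.Ioi (0 : ℝ), T p t := by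
    rw [integral_radial_mul hf hgm hint, ← integral_finsetSum _ hTint, ← integral_const_mul]
    refine setIntegral_congr_fun measurableSet_Ioi fun t ht => ?_
    simp only [hg]
    rw [Finset.mul_sum, Complex.ofReal_sum, Finset.sum_mul, Finset.mul_sum]
    exact Finset.sum_congr rfl fun p _ => mul_densityTerm h0 h1 hσ p _ ht
  have e3 : ∫ r in Set.Ioc (0 : ℝ) 1, (r : ℂ) * radialSum L α R f σ (r ^ (α - 1))
      = ((σ ^ 2 : ℝ) : ℂ) * ∑ p ∈ Q, ∫ t in Set.Ioi (0 : ℝ), T p t := by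
    have hi : ∀ p ∈ Q, IntegrableOn
        (fun r : ℝ => (r : ℂ) * circleInt f (α * σ * ‖p‖ * r ^ (α - 1))) (Set.Ioc 0 1) := by
      intro p _
      have := hcont.measurable
      refine Measure.integrableOn_of_bounded (by simp)
        (Measurable.aestronglyMeasurable (by fun_prop)) (M := 2 * Real.pi * K) ?_
      filter_upwards [ae_restrict_mem measurableSet_Ioc] with r hr
      rw [norm_mul, Complex.norm_real, Real.norm_of_nonneg hr.1.le]
      exact (mul_le_of_le_one_left (norm_nonneg _) hr.2).trans (norm_circleInt_le hK _)
    rw [← Finset.sum_congr rfl fun p hp =>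
      integral_Ioc_comp_rpow h1 (hpos p hp) (circleInt f), ← integral_finsetSum _ hi,
      ← integral_const_mul]
    refine setIntegral_congr_fun measurableSet_Ioc fun r hr => ?_
    simp only [radialSum]
    rw [mul_left_comm, Finset.mul_sum]
  rw [e1, e2, e3]
  push_cast
  ring

end

/-- The radial integrals converge to the integral of `f` against the limit density, for each of the
three regimes of `lam`. -/
theorem tendsto_radial_integral_scale {α : ℝ} (h0 : 0 < α) (h1 : α < 1)
    {L : Submodule ℤ ℂ} [DiscreteTopology L] [IsZLattice ℝ L]
    {f : ℂ → ℂ} (hf : Continuous f) (hfc : HasCompactSupport f) {R K : ℝ} (hR0 : 0 < R)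
    (hR : ∀ z, R < ‖z‖ → f z = 0) (hK : ∀ z, ‖f z‖ ≤ K) {φ : ℕ → ℝ}
    (hφ_pos : ∀ N : ℕ, 1 ≤ N → 0 < φ N) {lam : ℝ≥0∞}
    (hlam : Tendsto (fun N : ℕ => ENNReal.ofReal (φ N / (N : ℝ) ^ (1 - α))) atTop (𝓝 lam)) :
    Tendsto (fun N => ((ZLattice.covolume L : ℝ) : ℂ)⁻¹ * ∫ r in Set.Ioc (0 : ℝ) 1,
          (r : ℂ) * radialSum L α R f (scale α φ N) (r ^ (α - 1))) atTop
      (𝓝 (∫ z, (limitDensity α L lam z : ℂ) * f z)) := by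
  have hscale : ∀ N : ℕ, φ N / (N : ℝ) ^ (1 - α) = scale α φ N := by
    intro N
    rw [scale, div_eq_mul_inv, ← Real.rpow_neg (Nat.cast_nonneg _), neg_sub]
  simp_rw [hscale] at hlam
  have hpos : ∀ᶠ N in atTop, 0 < scale α φ N := by
    filter_upwards [eventually_ge_atTop 1] with N hN using scale_pos hN (hφ_pos N hN)
  by_cases hl : lam = ⊤
  · rw [hl, ENNReal.tendsto_ofReal_nhds_top] at hlam
    refine tendsto_const_nhds.congr' ?_
    filter_upwards [eventually_radialSum_eq_zero (L := L) (f := f) (R := R) h0 hlam] with N hN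
    simp [hN, limitDensity, hl]
  have hreal : Tendsto (scale α φ) atTop (𝓝 lam.toReal) := by
    refine ((ENNReal.tendsto_toReal hl).comp hlam).congr' ?_
    filter_upwards [hpos] with N hN
    exact ENNReal.toReal_ofReal hN.le
  by_cases hl0 : lam = 0
  · rw [hl0, ENNReal.toReal_zero] at hreal
    have h := (tendsto_radial_integral (L := L) h0 h1 hf hK hpos fun ρ hρ =>
      tendsto_radialSum_of_tendsto_zero h0 hf hR hK hpos hreal hρ).const_mul
        ((ZLattice.covolume L : ℝ) : ℂ)⁻¹
    convert h using 2
    simp_rw [mul_left_comm _ ((ZLattice.covolume L : ℝ) : ℂ)⁻¹]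
    rw [integral_const_mul, integral_radial_of_zero h0 h1 hf hfc hR]
    simp only [limitDensity, if_neg hl, if_pos hl0]
    rw [integral_const_mul, ← mul_assoc, ← mul_assoc]
    congr 1
    have : 2 - α ≠ 0 := by linarith
    have : ZLattice.covolume L ≠ 0 := ZLattice.covolume_ne_zero L _
    rw [← Complex.ofReal_inv, ← Complex.ofReal_mul, ← Complex.ofReal_mul]
    congr 1
    field_simp
  · have hσ : 0 < lam.toReal := ENNReal.toReal_pos hl0 hl
    rw [← integral_radial_of_pos h0 h1 hf hfc hR hK hl0 hl]
    exact (tendsto_radial_integral (L := L) h0 h1 hf hK hpos fun ρ hρ =>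
      tendsto_radialSum_of_pos h0 hf hR hR0 hσ hreal hρ).const_mul _

theorem mainTheorem3 (α : ℝ) (hα0 : 0 < α) (hα1 : α < 1)
    (L : Submodule ℤ ℂ) [DiscreteTopology L] [IsZLattice ℝ L]
    (Λ : Set ℂ) (hΛ : IsGridOf L Λ)
    (φ ψ : ℕ → ℝ) (hφ_pos : ∀ N : ℕ, 1 ≤ N → 0 < φ N)
    (hφ_top : Tendsto φ atTop atTop) (hψ_top : Tendsto ψ atTop atTop)
    (lam : ℝ≥0∞)
    (hlam : Tendsto (fun N : ℕ => ENNReal.ofReal (φ N / (N : ℝ) ^ (1 - α))) atTop (𝓝 lam))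
    (hψ : ∀ N : ℕ, 1 ≤ N → ψ N = ((N : ℝ) ^ (2 - α) / φ N) ^ 2) :
    VagueTendsto
      (fun t : ℕ × ℕ × ℕ => levelPairCorrelation α Λ φ ψ t.1 t.2.1 t.2.2)
      (comap (fun t : ℕ × ℕ × ℕ => min t.1 (t.2.1 + t.2.2)) atTop)
      (volume.withDensity fun z : ℂ => ENNReal.ofReal (limitDensity α L lam z)) := by
  refine ⟨fun t => ?_, isLocallyFiniteMeasure_limitDensity hα0 hα1 lam, fun f hf hfc => ?_⟩
  · have := isFiniteMeasure_levelPairCorrelation hΛ α φ ψ t.1 t.2.1 t.2.2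
    infer_instance
  obtain ⟨K, hK⟩ := hf.bounded_above_of_compact_support hfc
  obtain ⟨R, hR0, hsub⟩ := hfc.isCompact.isBounded.subset_closedBall_lt 0 0
  have hR : ∀ z, R < ‖z‖ → f z = 0 := by
    intro z hz
    by_contra h
    have := mem_closedBall_zero_iff.1 (hsub (subset_tsupport f h))
    linarith
  rw [integral_withDensity_limitDensity hα0 hα1]
  have hA := tendsto_integral_levelPairCorrelation_sub hα0 hα1 hΛ hf hfc hR0 hR hK hφ_pos hφ_top hψ
  have hB := (tendsto_radial_integral_scale (L := L) hα0 hα1 hf hfc hR0 hR hK hφ_pos hlam).comp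
    tendsto_fst_comap
  have := hA.add hB
  rw [zero_add] at this
  refine this.congr fun t => ?_
  simp only [Function.comp_apply, sub_add_cancel]
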